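/- **Tangential-sphere bound (TSB) for binary linear codes.** Let $n\ge 3$ and let $\mathcal C\subseteq\mathbb F_2^n$ be a binary linear code of dimension $k\ge 2$ with weight distribution $A_d=\#\{c\in\mathcal C:\mathrm{wt}(c)=d\}$. Codewords are equiprobable, sent as $s=(1-2c_t)_t\in\mathbb R^n$ over the channel $y=s+w$, $w\sim N(0,\sigma^2 I_n)$, $\sigma>0$, and decoded by a maximum-likelihood (nearest codeword) decoder with any tie-breaking; $\Pr\{E\}$ is the error probability. Let $s^{(0)}=(1,\dots,1)$ and let $Z$ be the component of the noise along $-s/\|s\|$, for the transmitted $s$. Put $$g(z)=\tfrac{1}{\sqrt{2\pi}\sigma}e^{-z^2/2\sigma^2},\quad g_s(r)=\frac{2r^{n-2}e^{-r^2/2\sigma^2}}{2^{(n-1)/2}\sigma^{n-1}\Gamma(\frac{n-1}2)},\quad F(x)=\frac{\Gamma(\frac{n-1}2)}{\sqrt\pi\,\Gamma(\frac{n-2}2)}\int_0^{\arccos x}\sin^{n-3}\phi\,d\phi .$$ *The bound for general codes.* For codewords $s\ne\hat s$ with $\delta_1=\|s\|$, $\delta_2=\|\hat s\|$, $\delta=\|\hat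 s-s\|$ put $\theta=\arccos\frac{\delta_1^2+\delta^2-\delta_2^2}{2\delta_1\delta}$, $\beta(z)=\frac{\delta-2z\cos\theta}{2\sin\theta}$. The pairwise error probability $p_2$ given $Z=z$ and given that the part of the noise orthogonal to $s$ has norm $r$ is: if $\beta(z)>0$, $F(\beta(z)/r)$ for $r\ge\beta(z)$ and $0$ otherwise; if $\beta(z)\le0$, $1-F(|\beta(z)|/r)$ for $r\ge|\beta(z)|$ and $1$ otherwise; if $\sin\theta=0$, it is $0$ when $\delta-2z\cos\theta>0$ and $1$ otherwise. Let $f_s(z,r|s)=\sum_{\hat s\ne s}p_2$ (grouped by the triangle distance spectrum), $f_u(z|s)=\int_0^\infty\min\{f_s(z,r|s),1\}g_s(r)\,dr$, let $f_u(z)$ be the average of $f_u(z|s)$ over the codewords, and $T(t)=\int_{-\infty}^{t}f_u(z)g(z)\,dz+\int_t^\infty g(z)\,dz$. For the bipolar image of $\mathcal C$ and every $\sigma>0$: 1. $f_u(z)=f_u(z|s^{(0)})$ for all $z$; $f_u(z)<1$ for $z<\sqrt n$ and $f_u(z)=1$ for $z\ge\sqrt n$. 2. $z^*=\sqrt n$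 is an optimal parameter: $T(\sqrt n)\le T(t)$ for all $t$, strictly if $t<\sqrt n$. Moreover $T(\sqrt n)$ equals the general bound $\int_{-\infty}^{\infty}\min\{\int_0^\infty\min\{\frac1{|\mathcal C|}\sum_s f_s(z,r|s),1\}g_s(r)dr,\,1\}g(z)\,dz$, and $\Pr\{E\}\le T(\sqrt n)$. 3. For $r>0$, $$f_s(0,r|s^{(0)})=\sum_{1\le d\le \frac{r^2n}{r^2+n}}A_d\,F\!\left(\tfrac{\sqrt{nd/(n-d)}}{r}\right).$$ *Assume in addition that $\mathcal C$ has at least three codewords different from the all-zero and the all-one word* (automatic unless $k=2$ and the all-one word is in $\mathcal C$). Then there is a unique $r_1\in(0,\infty)$ with $f_s(0,r_1|s^{(0)})=1$; it depends only on the code, not on $\sigma$, and it is also the unique positive solution of Poltyrev's equation $$\sum_{d:\ \sqrt d<r\sqrt{1-d/n}}A_d\int_0^{\arccos\frac{\sqrt d}{r\sqrt{1-d/n}}}\sin^{n-3}\phi\,d\phi=\frac{\sqrt\pi\,\Gamma(\frac{n-2}2)}{\Gamma(\frac{n-1}2)} .$$ For every $\sigma>0$: 4. For $z<\sqrt n$,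 $f_u(z)=\int_0^{r_1}f_s(0,r|s^{(0)})g_s(z,r)\,dr+\int_{r_1}^\infty g_s(z,r)\,dr$, where $g_s(z,\cdot)$ is $g_s$ with $\sigma$ replaced by $\tilde\sigma=\sqrt n\,\sigma/(\sqrt n-z)$. With this $f_u$, $$\Pr\{E\}\le\int_{-\infty}^{\sqrt n}f_u(z)g(z)\,dz+\Pr\{Z\ge\sqrt n\}=T(\sqrt n).$$ 5. For a measurable $A\subseteq\mathbb R^2$ let $R_A$ be the set of $y$ for which the radial component and the norm of the tangential part of $y-s^{(0)}$ form a pair in $A$. The region bound of $R_A$ is $\mathbb E[f_s(Z,\rho|s^{(0)})\mathbf 1_{y\in R_A}]+\Pr\{y\notin R_A\}$ for $y=s^{(0)}+w$, where $\rho$ is the tangential norm of $w$. The set $\{z<\sqrt n,\ \rho\le r_1(\sqrt n-z)/\sqrt n\}$ gives the half-cone $\{y:\angle(s^{(0)},y)\le\arctan(r_1/\sqrt n)\}$ (without its apex $0$). The region bound of this half-cone is $T(\sqrt n)$, the minimum over all measurable $A$, and every minimizing region equals it up to a null set. 6. $T(\sqrt n)$ equals Poltyrev's TSB with correction term, $$\int_{-\infty}^{\sqrt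 n}g(z)\Big\{\sum_{d:\ \sqrt d<r_1\sqrt{1-d/n}}A_d\int_{\beta_d(z)}^{r_z}g(z_2)\int_0^{r_z^2-z_2^2}f_V(v)\,dv\,dz_2+1-\int_0^{r_z^2}f_Y(y)\,dy\Big\}dz+Q\!\left(\tfrac{\sqrt n}{\sigma}\right),$$ where $r_z=r_1(1-z/\sqrt n)$, $\beta_d(z)=\sqrt d(\sqrt n-z)/\sqrt{n-d}$, $f_V$ and $f_Y$ are the densities of sums of $n-2$ and $n-1$ squares of independent $N(0,\sigma^2)$ variables, and $Q(x)=\int_x^\infty\frac1{\sqrt{2\pi}}e^{-u^2/2}du$. *If $\mathcal C$ has fewer than three codewords different from the all-zero and the all-one word*, then $f_s(0,r|s^{(0)})<1$ for all $r>0$ (the optimal radius is $+\infty$), and $f_u(z)=\int_0^\infty f_s(0,r|s^{(0)})g_s(z,r)\,dr$ for all $z<\sqrt n$ and $\sigma>0$. -/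

import Mathlib

open MeasureTheory ProbabilityTheory
open scoped Classical

noncomputable section

namespace TSB

/-- Signal space `ℝⁿ` with the Euclidean norm. -/
abbrev Sig (n : ℕ) : Type := EuclideanSpace ℝ (Fin n)

/-! ### The AWGN channel and maximum-likelihood decoding -/

/-- The law of the noise vector: `n` independent centred Gaussians of variance `σ²`. -/
def awgn (n : ℕ) (σ : ℝ) : Measure (Sig n) :=
  (stdGaussian (Sig n)).map (fun w => σ • w)

/-- `D` maps every received vector to a nearest codeword; ties are broken arbitrarily. -/
def IsMLDecoder {n : ℕ} (S : Finset (Sig n)) (D : Sig n → Sig n) : Prop :=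
  ∀ y, D y ∈ S ∧ ∀ s ∈ S, dist y (D y) ≤ dist y s

/-- `Pr{E}`: decoding error probability for equiprobable codewords. -/
def errorProb {n : ℕ} (S : Finset (Sig n)) (D : Sig n → Sig n) (σ : ℝ) : ℝ :=
  ∑ s ∈ S, (1 / (S.card : ℝ)) * (awgn n σ).real {w | D (s + w) ≠ s}

/-! ### The tangential-sphere bound for a general code -/

/-- `Γ((n-1)/2) / (√π Γ((n-2)/2)) ∫_0^{arccos x} sin^{n-3} φ dφ`. -/
def capRatio (n : ℕ) (x : ℝ) : ℝ :=
  Real.Gamma (((n : ℝ) - 1) / 2) / (Real.sqrt Real.pi * Real.Gamma (((n : ℝ) - 2) / 2)) *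
    ∫ φ in (0 : ℝ)..Real.arccos x, Real.sin φ ^ (n - 3)

/-- The angle at the transmitted signal `s` between the directions of the origin and of `ŝ`,
where `δ₁ = ‖s‖`, `δ₂ = ‖ŝ‖` and `δ = ‖ŝ - s‖`. -/
def theta (δ₁ δ₂ δ : ℝ) : ℝ :=
  Real.arccos ((δ₁ ^ 2 + δ ^ 2 - δ₂ ^ 2) / (2 * δ₁ * δ))

/-- `β_d(z)`; only used when `sin θ ≠ 0`. -/
def beta (z δ₁ δ₂ δ : ℝ) : ℝ :=
  (δ - 2 * z * Real.cos (theta δ₁ δ₂ δ)) / (2 * Real.sin (theta δ₁ δ₂ δ))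

/-- Conditional pair-wise error probability given that the radial noise component is `z` and the
tangential noise has norm `r`. If `sin θ = 0` (the signals `s`, `ŝ` are collinear with the origin),
then `β_d(z)` is `+∞` or `-∞` and the value is `0` or `1`. -/
def p₂ (n : ℕ) (z r δ₁ δ₂ δ : ℝ) : ℝ :=
  if Real.sin (theta δ₁ δ₂ δ) = 0 then
    if 0 < δ - 2 * z * Real.cos (theta δ₁ δ₂ δ) then 0 else 1
  else if 0 < beta z δ₁ δ₂ δ then
    if beta z δ₁ δ₂ δ ≤ r then capRatio n (beta z δ₁ δ₂ δ / r) else 0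
  else
    if |beta z δ₁ δ₂ δ| ≤ r then 1 - capRatio n (|beta z δ₁ δ₂ δ| / r) else 1

/-- Triangle Euclidean distance spectrum `B_{δ₁,δ₂,δ|s}`. -/
def triSpectrum {n : ℕ} (S : Finset (Sig n)) (s : Sig n) (δ₁ δ₂ δ : ℝ) : ℕ :=
  ((S.erase s).filter (fun t => ‖s‖ = δ₁ ∧ ‖t‖ = δ₂ ∧ dist t s = δ)).card

/-- `f_s(z, r | s)`: the conditional union bound on the sphere of radius `r` in the hyperplane
`Z = z`; the sum is over all triples `(δ₁, δ₂, δ)` with `B_{δ₁,δ₂,δ|s} ≠ 0`. -/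
def fs {n : ℕ} (S : Finset (Sig n)) (z r : ℝ) (s : Sig n) : ℝ :=
  ∑ δ ∈ (S.erase s).image (fun t => (‖s‖, ‖t‖, dist t s)),
    (triSpectrum S s δ.1 δ.2.1 δ.2.2 : ℝ) * p₂ n z r δ.1 δ.2.1 δ.2.2

/-- The density `g` of the radial noise component. -/
def g (σ z : ℝ) : ℝ :=
  1 / (Real.sqrt (2 * Real.pi) * σ) * Real.exp (-z ^ 2 / (2 * σ ^ 2))

/-- The density `g_s` of the norm of the `(n-1)`-dimensional tangential noise. -/
def gs (n : ℕ) (σ r : ℝ) : ℝ :=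
  2 * r ^ (n - 2) * Real.exp (-r ^ 2 / (2 * σ ^ 2)) /
    ((2 : ℝ) ^ (((n : ℝ) - 1) / 2) * σ ^ (n - 1) * Real.Gamma (((n : ℝ) - 1) / 2))

/-- `f_u(z | s)`: the conditional sphere bound given `Z = z`. -/
def fuCond {n : ℕ} (S : Finset (Sig n)) (σ z : ℝ) (s : Sig n) : ℝ :=
  ∫ r in Set.Ioi (0 : ℝ), min (fs S z r s) 1 * gs n σ r

/-- `f_u(z) = ∑_s Pr{s} f_u(z | s)`. -/
def fu {n : ℕ} (S : Finset (Sig n)) (σ z : ℝ) : ℝ :=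
  ∑ s ∈ S, (1 / (S.card : ℝ)) * fuCond S σ z s

/-- The parameterized bound with parameter `t`:
`∫_{-∞}^t f_u(z) g(z) dz + ∫_t^∞ g(z) dz`. -/
def tsbValue {n : ℕ} (S : Finset (Sig n)) (σ t : ℝ) : ℝ :=
  (∫ z in Set.Iic t, fu S σ z * g σ z) + ∫ z in Set.Ioi t, g σ z

/-- The tangential-sphere bound for general codes:
`∫ min{∫_0^∞ min{∑_s Pr{s} f_s(z, r | s), 1} g_s(r) dr, 1} g(z) dz`. -/
def generalTSB {n : ℕ} (S : Finset (Sig n)) (σ : ℝ) : ℝ :=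
  ∫ z : ℝ, min (∫ r in Set.Ioi (0 : ℝ),
    min (∑ s ∈ S, (1 / (S.card : ℝ)) * fs S z r s) 1 * gs n σ r) 1 * g σ z

/-! ### Gallager regions -/

/-- The radial component of the vector `w`, along `-s/‖s‖`. -/
def radial {n : ℕ} (s w : Sig n) : ℝ := inner ℝ w (-(‖s‖⁻¹ • s))

/-- The norm of the tangential part of the vector `w`. -/
def tangential {n : ℕ} (s w : Sig n) : ℝ := ‖w - radial s w • (-(‖s‖⁻¹ • s))‖

/-- The region of those received vectors `y` for which the radial component of `y - s` and the norm
of its tangential part form a pair in `A`. -/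
def region {n : ℕ} (s : Sig n) (A : Set (ℝ × ℝ)) : Set (Sig n) :=
  {y | (radial s (y - s), tangential s (y - s)) ∈ A}

/-- Gallager's first bound with region `R`, given that `s` is sent: the union bound, conditional
on the radial component and the tangential norm, integrated over `{y ∈ R}`, plus `Pr{y ∉ R}`. -/
def regionBound {n : ℕ} (S : Finset (Sig n)) (σ : ℝ) (s : Sig n) (R : Set (Sig n)) : ℝ :=
  (∫ w in {w | s + w ∈ R}, fs S (radial s w) (tangential s w) s ∂(awgn n σ)) +
    (awgn n σ).real {w | s + w ∉ R}

/-- The half-cone with apex at the origin, axis through `s` and half-angle `α`. -/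
def halfCone {n : ℕ} (s : Sig n) (α : ℝ) : Set (Sig n) :=
  {y | InnerProductGeometry.angle s y ≤ α}

/-! ### Binary linear codes -/

/-- Bipolar image of a binary word: `s_t = 1 - 2 c_t`. -/
def bpsk {n : ℕ} (c : Fin n → ZMod 2) : Sig n :=
  WithLp.toLp 2 (fun t => 1 - 2 * ((c t).val : ℝ))

/-- The set of bipolar images of the codewords. -/
def signals {n : ℕ} (C : Submodule (ZMod 2) (Fin n → ZMod 2)) : Finset (Sig n) :=
  (Finset.univ.filter (fun c => c ∈ C)).image bpsk

/-- `A_d`: the number of codewords of Hamming weight `d`. -/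
def weightCount {n : ℕ} (C : Submodule (ZMod 2) (Fin n → ZMod 2)) (d : ℕ) : ℕ :=
  (Finset.univ.filter (fun c => c ∈ C ∧ hammingNorm c = d)).card

/-- `∑_{1 ≤ d ≤ r²n/(r²+n)} A_d Γ((n-1)/2)/(√π Γ((n-2)/2)) ∫_0^{arccos(√(nd/(n-d))/r)} sin^{n-3}`. -/
def sphereSum {n : ℕ} (C : Submodule (ZMod 2) (Fin n → ZMod 2)) (r : ℝ) : ℝ :=
  ∑ d ∈ (Finset.Icc 1 n).filter (fun d : ℕ => (d : ℝ) ≤ r ^ 2 * n / (r ^ 2 + n)),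
    (weightCount C d : ℝ) *
      capRatio n (Real.sqrt ((n : ℝ) * d / ((n : ℝ) - d)) / r)

/-- `σ̃ = √n σ / (√n - z)`. -/
def sigmaTilde (n : ℕ) (σ z : ℝ) : ℝ :=
  Real.sqrt n * σ / (Real.sqrt n - z)

/-- The conditional sphere bound with radius `r₁`:
`∫_0^{r₁} f_s(0, r) g_s(z, r) dr + ∫_{r₁}^∞ g_s(z, r) dr`. -/
def fuLinear {n : ℕ} (C : Submodule (ZMod 2) (Fin n → ZMod 2)) (r₁ σ z : ℝ) : ℝ :=
  (∫ r in (0 : ℝ)..r₁, sphereSum C r * gs n (sigmaTilde n σ z) r) +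
    ∫ r in Set.Ioi r₁, gs n (sigmaTilde n σ z) r

/-! ### The tangential-sphere bound of Poltyrev -/

/-- `Q(x) = ∫_x^∞ e^{-z²/2}/√(2π) dz`. -/
def Q (x : ℝ) : ℝ :=
  ∫ z in Set.Ioi x, 1 / Real.sqrt (2 * Real.pi) * Real.exp (-z ^ 2 / 2)

/-- Density of the sum of the squares of `m` independent centred Gaussians of variance `σ²`, at
positive arguments. -/
def chiSqPDF (m : ℝ) (σ v : ℝ) : ℝ :=
  v ^ ((m - 2) / 2) * Real.exp (-v / (2 * σ ^ 2)) /
    ((2 : ℝ) ^ (m / 2) * σ ^ m * Real.Gamma (m / 2))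

/-- The weights `d` with `δ_d/2 < α_d`, where `δ_d = 2√d` and `α_d = r √(1 - δ_d²/(4n))`. -/
def poltyrevWeights (n : ℕ) (r : ℝ) : Finset ℕ :=
  (Finset.Icc 1 n).filter
    (fun d : ℕ => Real.sqrt (d : ℝ) < r * Real.sqrt (1 - (d : ℝ) / n))

/-- Optimality equation for the radius of the cone:
`∑_d A_d ∫_0^{θ_d} sin^{n-3} φ dφ = √π Γ((n-2)/2) / Γ((n-1)/2)`, `θ_d = arccos(δ_d/(2α_d))`. -/
def PoltyrevOptimal {n : ℕ} (C : Submodule (ZMod 2) (Fin n → ZMod 2)) (r : ℝ) : Prop :=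
  ∑ d ∈ poltyrevWeights n r, (weightCount C d : ℝ) *
      ∫ φ in (0 : ℝ)..Real.arccos (Real.sqrt (d : ℝ) / (r * Real.sqrt (1 - (d : ℝ) / n))),
        Real.sin φ ^ (n - 3)
    = Real.sqrt Real.pi * Real.Gamma (((n : ℝ) - 2) / 2) / Real.Gamma (((n : ℝ) - 1) / 2)

/-- `r_z = r (1 - z/√n)`. -/
def coneRadius (n : ℕ) (r z : ℝ) : ℝ := r * (1 - z / Real.sqrt n)

/-- The bound for a cone of radius `r` at the transmitted signal, with correction term:
`∫_{-∞}^{√n} g(z) {∑_d A_d ∫_{β_d(z)}^{r_z} g(z₂) ∫_0^{r_z² - z₂²} f_V(v) dv dz₂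
  + 1 - ∫_0^{r_z²} f_Y(y) dy} dz + Q(√n/σ)`,
where `V`, `Y` are sums of `n - 2` and `n - 1` squared noise components. -/
def poltyrevTSB {n : ℕ} (C : Submodule (ZMod 2) (Fin n → ZMod 2)) (r σ : ℝ) : ℝ :=
  (∫ z in Set.Iic (Real.sqrt n), g σ z *
    ((∑ d ∈ poltyrevWeights n r, (weightCount C d : ℝ) *
        ∫ z₂ in (Real.sqrt (d : ℝ) * (Real.sqrt n - z) / Real.sqrt ((n : ℝ) - d))..coneRadius n r z,
          g σ z₂ * ∫ v in (0 : ℝ)..(coneRadius n r z ^ 2 - z₂ ^ 2), chiSqPDF ((n : ℝ) - 2) σ v)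
      + (1 - ∫ y in (0 : ℝ)..(coneRadius n r z ^ 2), chiSqPDF ((n : ℝ) - 1) σ y)))
  + Q (Real.sqrt n / σ)

end TSB

end

/-!
Split the noise into its component `Z` along the axis `-s/‖s‖` and the tangential part, of norm
`ρ`. In an orthonormal basis whose first two vectors are the axis and a tangential unit vector `e`
the noise has independent Gaussian coordinates, and polar coordinates in the half-plane spanned by
`e` and the norm of the remaining `n - 2` coordinates show (`polar_pushforward`,
`map_awgn_components`) that `Z`, `ρ` and the angle `φ` between the tangential part and `e` are
independent, with densities `g`, `gs n` and a multiple of `sin φ ^ (n - 3)`. The same computation,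
by induction on the dimension, gives the density of the norm. Nearness to a competing codeword at
Hamming distance `d` is the half-space `ρ cos φ ≥ boundary n d Z`, so its probability given
`(Z, ρ)` is the cap ratio `p₂` (`awgn_pairwise_event`).

By linearity the conditional union bound is one function `condUnion C` of `(z, ρ)` for all
transmitted codewords (`fs_signals`), and it exceeds `1` for `z ≥ √n`, where each of the at least
three nonzero codewords contributes at least `1 / 2`. The bound with parameter `√n` is therefore the
integral of `min (condUnion C) 1` against the law of `(Z, ρ)` (`tsbValue_sqrt`). Gallager's bound
for a region integrates `condUnion C` on a set `A` and `1` off `A`; it exceeds that integral by two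
nonnegative terms, which vanish iff `A` lies between `{condUnion C < 1}` and `{condUnion C ≤ 1}` up
to null sets (`regionBound_eq_tsbValue_iff`). The union bound on `{condUnion C < 1, Z < √n}` gives
the estimate of the error probability (`awgn_error_le`).

For `z < √n` the decision boundaries scale linearly with the distance `√n - z` to the origin, so
`condUnion C (z, r) = sphereSum C (r √n / (√n - z))` (`condUnion_eq_sphereSum`). The function
`sphereSum C` vanishes near `0`, is strictly increasing where it is positive, and tends to half the
number of codewords other than the all-zero and all-one words. Hence it takes the value `1` at
exactly one radius `r₁` if there are at least three such words and stays below `1` otherwise, and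
`{condUnion C ≤ 1}` is the cone of slope `r₁ / √n` with apex at the origin. Poltyrev's formula
arises by computing the probability of a cap of a ball in Cartesian instead of polar coordinates
(`integral_g_mul_integral_chiSqPDF`).
-/

noncomputable section

namespace TSB

/-! ### Gaussian vectors in polar coordinates -/

/-- The law of one coordinate of the noise. -/
def noiseLaw (σ : ℝ) : Measure ℝ := gaussianReal 0 (Real.toNNReal (σ ^ 2))

/-- The law of the norm of an `m`-dimensional noise vector, `1 ≤ m`, defined by its density
`gs (m + 1) σ`: the argument of `gs` is the dimension of the signal space, one more than that of
the tangential hyperplane. -/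
def chiLaw (m : ℕ) (σ : ℝ) : Measure ℝ :=
  (volume.restrict (Set.Ioi 0)).withDensity (fun r => ENNReal.ofReal (gs (m + 1) σ r))

/-- The normalizing constant of `∫ φ in 0..π, sin φ ^ (m - 1)`, written as in `capRatio (m + 2)`. -/
def angleConst (m : ℕ) : ℝ :=
  Real.Gamma ((m + 1) / 2) / (Real.sqrt Real.pi * Real.Gamma (m / 2))

/-- The law of the angle between an `(m + 1)`-dimensional noise vector, `1 ≤ m`, and a fixed axis,
defined by its density on `(0, π)`. -/
def angleLaw (m : ℕ) : Measure ℝ :=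
  (volume.restrict (Set.Ioo 0 Real.pi)).withDensity
    (fun φ => ENNReal.ofReal (angleConst m * Real.sin φ ^ (m - 1)))

instance (σ : ℝ) : IsProbabilityMeasure (noiseLaw σ) := by unfold noiseLaw; infer_instance

instance (m : ℕ) (σ : ℝ) : SFinite (chiLaw m σ) := by unfold chiLaw; infer_instance

instance (m : ℕ) : SFinite (angleLaw m) := by unfold angleLaw; infer_instance

lemma ae_pos_chiLaw (m : ℕ) (σ : ℝ) : ∀ᵐ r ∂(chiLaw m σ), 0 < r :=
  (withDensity_absolutelyContinuous _ _).ae_le (ae_restrict_mem measurableSet_Ioi)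

lemma gs_succ (m : ℕ) (σ r : ℝ) : gs (m + 1) σ r =
    2 * r ^ (m - 1) * Real.exp (-r ^ 2 / (2 * σ ^ 2)) /
      ((2 : ℝ) ^ ((m : ℝ) / 2) * σ ^ m * Real.Gamma ((m : ℝ) / 2)) := by
  have h1 : m + 1 - 2 = m - 1 := by omega
  simp [gs, h1]

lemma capRatio_add_two (m : ℕ) (x : ℝ) : capRatio (m + 2) x =
    angleConst m * ∫ φ in (0 : ℝ)..Real.arccos x, Real.sin φ ^ (m - 1) := by
  have h1 : m + 2 - 3 = m - 1 := by omega
  have h2 : ((m : ℝ) + 2 - 1) / 2 = (m + 1) / 2 := by ring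
  simp [capRatio, angleConst, h1, h2]

lemma angleConst_pos {m : ℕ} (hm : 1 ≤ m) : 0 < angleConst m := by
  have : (0 : ℝ) < m := by exact_mod_cast hm
  unfold angleConst
  have h1 := Real.Gamma_pos_of_pos (show (0 : ℝ) < (m + 1) / 2 by positivity)
  have h2 := Real.Gamma_pos_of_pos (show (0 : ℝ) < m / 2 by positivity)
  positivity

lemma gs_pos {m : ℕ} (hm : 1 ≤ m) {σ r : ℝ} (hσ : 0 < σ) (hr : 0 < r) : 0 < gs (m + 1) σ r := by
  have : (0 : ℝ) < m := by exact_mod_cast hm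
  rw [gs_succ]
  have h2 := Real.Gamma_pos_of_pos (show (0 : ℝ) < m / 2 by positivity)
  positivity

lemma continuous_gs (n : ℕ) (σ : ℝ) : Continuous (gs n σ) := by
  unfold gs; fun_prop

@[fun_prop]
lemma measurable_gs (n : ℕ) (σ : ℝ) : Measurable (gs n σ) := (continuous_gs n σ).measurable

lemma integrableOn_gs {m : ℕ} (hm : 1 ≤ m) {σ : ℝ} (hσ : 0 < σ) :
    IntegrableOn (gs (m + 1) σ) (Set.Ioi 0) := by
  have hm' : (1 : ℝ) ≤ m := by exact_mod_cast hm
  have h := integrableOn_rpow_mul_exp_neg_mul_rpow (s := ((m - 1 : ℕ) : ℝ)) (p := 2)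
    (b := 1 / (2 * σ ^ 2)) (by have : (0 : ℝ) ≤ ((m - 1 : ℕ) : ℝ) := by positivity
                               linarith) (by norm_num) (by positivity)
  refine (h.const_mul (2 / ((2 : ℝ) ^ ((m : ℝ) / 2) * σ ^ m * Real.Gamma ((m : ℝ) / 2)))).congr ?_
  filter_upwards with r
  rw [gs_succ, Real.rpow_natCast, Real.rpow_two]
  have : -(1 / (2 * σ ^ 2)) * r ^ 2 = -r ^ 2 / (2 * σ ^ 2) := by ring
  rw [this]; ring

lemma integral_gs {m : ℕ} (hm : 1 ≤ m) {σ : ℝ} (hσ : 0 < σ) :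
    ∫ r in Set.Ioi 0, gs (m + 1) σ r = 1 := by
  have hm' : (0 : ℝ) < m := by exact_mod_cast hm
  have h := integral_rpow_mul_exp_neg_mul_rpow (q := ((m - 1 : ℕ) : ℝ)) (p := 2)
    (b := 1 / (2 * σ ^ 2)) (by norm_num) (by have : (0 : ℝ) ≤ ((m - 1 : ℕ) : ℝ) := by positivity
                                             linarith) (by positivity)
  have hG := Real.Gamma_pos_of_pos (show (0 : ℝ) < m / 2 by positivity)
  have key : ∀ r, gs (m + 1) σ r = (2 / ((2 : ℝ) ^ ((m : ℝ) / 2) * σ ^ m *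
      Real.Gamma ((m : ℝ) / 2))) *
      (r ^ ((m - 1 : ℕ) : ℝ) * Real.exp (-(1 / (2 * σ ^ 2)) * r ^ (2 : ℝ))) := fun r => by
    rw [gs_succ, Real.rpow_natCast, Real.rpow_two]
    have : -(1 / (2 * σ ^ 2)) * r ^ 2 = -r ^ 2 / (2 * σ ^ 2) := by ring
    rw [this]; ring
  simp_rw [key]
  rw [integral_const_mul, h]
  have e1 : ((m - 1 : ℕ) : ℝ) + 1 = m := by push_cast [hm]; ring
  rw [e1]
  have e2 : (1 / (2 * σ ^ 2)) ^ (-(m : ℝ) / 2) = (2 : ℝ) ^ ((m : ℝ) / 2) * σ ^ m := by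
    rw [one_div, Real.inv_rpow (by positivity), neg_div, Real.rpow_neg (by positivity), inv_inv,
      Real.mul_rpow (by norm_num) (by positivity), ← Real.rpow_natCast σ 2,
      ← Real.rpow_mul hσ.le, ← Real.rpow_natCast σ m]
    congr 2
    push_cast; ring
  rw [e2]
  field_simp

lemma isProbabilityMeasure_chiLaw {m : ℕ} (hm : 1 ≤ m) {σ : ℝ} (hσ : 0 < σ) :
    IsProbabilityMeasure (chiLaw m σ) := by
  constructor
  rw [chiLaw, withDensity_apply _ MeasurableSet.univ, Measure.restrict_univ,
    ← ofReal_integral_eq_lintegral_ofReal (integrableOn_gs hm hσ), integral_gs hm hσ,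
    ENNReal.ofReal_one]
  filter_upwards [ae_restrict_mem measurableSet_Ioi] with r hr using (gs_pos hm hσ hr).le

lemma g_eq_gaussianPDFReal {σ : ℝ} (hσ : 0 < σ) :
    g σ = gaussianPDFReal 0 (Real.toNNReal (σ ^ 2)) := by
  ext z
  have h : Real.sqrt (2 * Real.pi * σ ^ 2) = Real.sqrt (2 * Real.pi) * σ := by
    rw [Real.sqrt_mul (by positivity), Real.sqrt_sq hσ.le]
  simp [g, gaussianPDFReal, Real.coe_toNNReal _ (sq_nonneg σ), h]

lemma noiseLaw_eq {σ : ℝ} (hσ : 0 < σ) :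
    noiseLaw σ = volume.withDensity (fun z => ENNReal.ofReal (g σ z)) := by
  rw [noiseLaw, gaussianReal_of_var_ne_zero _ (by simp [hσ.ne']), g_eq_gaussianPDFReal hσ]
  rfl

lemma continuous_g (σ : ℝ) : Continuous (g σ) := by
  unfold g; fun_prop

@[fun_prop]
lemma measurable_g (σ : ℝ) : Measurable (g σ) := (continuous_g σ).measurable

lemma g_pos {σ : ℝ} (hσ : 0 < σ) (z : ℝ) : 0 < g σ z := by
  unfold g; positivity

/-- In polar coordinates the Gaussian weight of a half-plane splits into a radial and an angular
factor. -/
lemma mul_g_mul_gs_polar {m : ℕ} (hm : 1 ≤ m) {σ r : ℝ} (hσ : 0 < σ) (φ : ℝ) :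
    r * (g σ (r * Real.cos φ) * gs (m + 1) σ (r * Real.sin φ)) =
      gs (m + 1 + 1) σ r * (angleConst m * Real.sin φ ^ (m - 1)) := by
  have hm' : (0 : ℝ) < m := by exact_mod_cast hm
  have hG := Real.Gamma_pos_of_pos (show (0 : ℝ) < m / 2 by positivity)
  have hG' := Real.Gamma_pos_of_pos (show (0 : ℝ) < (m + 1) / 2 by positivity)
  rw [gs_succ, gs_succ, g, angleConst]
  have e1 : Real.exp (-r ^ 2 / (2 * σ ^ 2)) = Real.exp (-(r * Real.cos φ) ^ 2 / (2 * σ ^ 2)) *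
      Real.exp (-(r * Real.sin φ) ^ 2 / (2 * σ ^ 2)) := by
    rw [← Real.exp_add]; congr 1
    rw [mul_pow, mul_pow, Real.cos_sq']; ring
  have e2 : (2 : ℝ) ^ (((m + 1 : ℕ) : ℝ) / 2) = 2 ^ ((m : ℝ) / 2) * Real.sqrt 2 := by
    rw [Real.sqrt_eq_rpow, ← Real.rpow_add (by norm_num)]; congr 1; push_cast; ring
  have e3 : r ^ (m + 1 - 1) = r * r ^ (m - 1) := by
    rw [← pow_succ']; congr 1; omega
  rw [e1, e2, e3, Real.sqrt_mul (by norm_num)]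
  rw [mul_pow r]
  push_cast
  field_simp
  ring

/-- For one coordinate of the noise and an independent norm of `m` further coordinates, radius and
angle are independent. -/
lemma polar_pushforward {m : ℕ} (hm : 1 ≤ m) {σ : ℝ} (hσ : 0 < σ) :
    (noiseLaw σ).prod (chiLaw m σ) = ((chiLaw (m + 1) σ).prod (angleLaw m)).map
      (fun p => (p.1 * Real.cos p.2, p.1 * Real.sin p.2)) := by
  have := isProbabilityMeasure_chiLaw hm hσ
  have hpol : Measurable (fun p : ℝ × ℝ => (p.1 * Real.cos p.2, p.1 * Real.sin p.2)) := by
    fun_prop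
  ext s hs
  rw [Measure.map_apply hpol hs]
  rw [noiseLaw_eq hσ, chiLaw, chiLaw, angleLaw, prod_withDensity (by fun_prop) (by fun_prop),
    prod_withDensity (by fun_prop) (by fun_prop), withDensity_apply _ hs,
    withDensity_apply _ (hpol hs)]
  -- Write both sides as integrals over `ℝ × ℝ` and change to polar coordinates on the left.
  nth_rw 1 [← Measure.restrict_univ (μ := (volume : Measure ℝ))]
  rw [Measure.prod_restrict, Measure.prod_restrict, ← Measure.volume_eq_prod,
    Measure.restrict_restrict hs, Measure.restrict_restrict (hpol hs),
    ← lintegral_indicator (hs.inter (MeasurableSet.univ.prod measurableSet_Ioi)),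
    ← lintegral_indicator ((hpol hs).inter (measurableSet_Ioi.prod measurableSet_Ioo)),
    ← lintegral_comp_polarCoord_symm,
    ← lintegral_indicator (polarCoord.open_target.measurableSet)]
  congr 1
  ext ⟨r, φ⟩
  by_cases hr : 0 < r
  swap
  · rw [Set.indicator_of_notMem (by simp [hr]), Set.indicator_of_notMem (by simp [hr])]
  by_cases hφ : 0 < φ ∧ φ < Real.pi
  · have hsin := Real.sin_pos_of_pos_of_lt_pi hφ.1 hφ.2
    rw [Set.indicator_of_mem (by simp [hr, hφ.2]; linarith [hφ.1])]
    by_cases hmem : (r * Real.cos φ, r * Real.sin φ) ∈ s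
    · rw [Set.indicator_of_mem (by simp [hr, hsin, hmem]), Set.indicator_of_mem
        (by simp [hr, hφ.1, hφ.2, hmem])]
      simp only [polarCoord_symm_apply, smul_eq_mul]
      rw [← ENNReal.ofReal_mul (g_pos hσ _).le, ← ENNReal.ofReal_mul hr.le,
        ← ENNReal.ofReal_mul (gs_pos (Nat.le_add_left 1 m) hσ hr).le, mul_g_mul_gs_polar hm hσ]
    · rw [Set.indicator_of_notMem (by simp [hmem]), Set.indicator_of_notMem (by simp [hmem])]
      simp
  · rw [Set.indicator_of_notMem (a := (r, φ)) (s := _ ∩ _) (by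
      simp only [Set.mem_inter_iff, Set.mem_prod, Set.mem_Ioo]; tauto)]
    -- Angles in `(-π, 0]` correspond to the lower half-plane, where the density vanishes.
    by_cases hφ' : φ ∈ Set.Ioo (-Real.pi) Real.pi
    · have : Real.sin φ ≤ 0 := Real.sin_nonpos_of_nonpos_of_neg_pi_le
        (by by_contra h; exact hφ ⟨not_le.1 h, hφ'.2⟩) hφ'.1.le
      rw [Set.indicator_of_mem (by simp [hr]; exact hφ'), Set.indicator_of_notMem]
      · simp
      · simp only [polarCoord_symm_apply, Set.mem_inter_iff, Set.mem_prod, Set.mem_Ioi, not_and]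
        intro _ _
        nlinarith
    · rw [Set.indicator_of_notMem (by
        simp only [polarCoord_target, Set.mem_prod]; tauto)]

/-- Total mass `1` is read off from `polar_pushforward`, all other factors being probability
measures; this evaluates `∫ φ in 0..π, sin φ ^ (m - 1)`. -/
lemma isProbabilityMeasure_angleLaw {m : ℕ} (hm : 1 ≤ m) :
    IsProbabilityMeasure (angleLaw m) := by
  have h1 := isProbabilityMeasure_chiLaw hm one_pos
  have h2 := isProbabilityMeasure_chiLaw (Nat.le_add_left 1 m) one_pos
  constructor
  have h := congrArg (fun μ => μ Set.univ) (polar_pushforward hm one_pos)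
  rw [Measure.map_apply (by fun_prop) MeasurableSet.univ, Set.preimage_univ, measure_univ,
    ← Set.univ_prod_univ, Measure.prod_prod, measure_univ, one_mul] at h
  exact h.symm

lemma map_norm_prod_chiLaw {m : ℕ} (hm : 1 ≤ m) {σ : ℝ} (hσ : 0 < σ) :
    ((noiseLaw σ).prod (chiLaw m σ)).map (fun p => Real.sqrt (p.1 ^ 2 + p.2 ^ 2)) =
      chiLaw (m + 1) σ := by
  have h2 := isProbabilityMeasure_chiLaw (Nat.le_add_left 1 m) hσ
  have h3 := isProbabilityMeasure_angleLaw hm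
  rw [polar_pushforward hm hσ, Measure.map_map (by fun_prop) (by fun_prop)]
  have : ((chiLaw (m + 1) σ).prod (angleLaw m)).map Prod.fst = chiLaw (m + 1) σ := by
    simp
  refine Eq.trans ?_ this
  refine Measure.map_congr ?_
  have : ∀ᵐ p ∂((chiLaw (m + 1) σ).prod (angleLaw m)), 0 < p.1 :=
      Measure.quasiMeasurePreserving_fst.ae (ae_pos_chiLaw (m + 1) σ)
  filter_upwards [this] with p hp
  simp only [Function.comp]
  rw [show (p.1 * Real.cos p.2) ^ 2 + (p.1 * Real.sin p.2) ^ 2 = p.1 ^ 2 by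
    rw [mul_pow, mul_pow, Real.cos_sq']; ring, Real.sqrt_sq hp.le]

lemma map_abs_noiseLaw {σ : ℝ} (hσ : 0 < σ) : (noiseLaw σ).map (fun x => |x|) = chiLaw 1 σ := by
  have hg : ∀ r, gs (1 + 1) σ r = 2 * g σ r := fun r => by
    have h := Real.Gamma_one_half_eq
    rw [gs_succ, g]
    simp only [Nat.cast_one, h, ← Real.sqrt_eq_rpow, Real.sqrt_mul (show (0:ℝ) ≤ 2 by norm_num)]
    have : 0 < Real.sqrt Real.pi := by positivity
    field_simp
    simp
  have hneg : ∀ z, g σ (-z) = g σ z := fun z => by simp [g]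
  ext s hs
  have habs : Measurable (fun x : ℝ => |x|) := continuous_abs.measurable
  rw [Measure.map_apply habs hs, noiseLaw_eq hσ, withDensity_apply _ (habs hs), chiLaw,
    withDensity_apply _ hs, Measure.restrict_restrict hs, ← lintegral_indicator (habs hs),
    ← lintegral_add_compl _ (measurableSet_Ioi (a := (0 : ℝ))), Set.compl_Ioi,
    setLIntegral_congr Iio_ae_eq_Iic.symm,
    ← lintegral_indicator (hs.inter measurableSet_Ioi)]
  have h2 : ∫⁻ x in Set.Iio 0, ((fun x : ℝ => |x|) ⁻¹' s).indicator
        (fun a => ENNReal.ofReal (g σ a)) x =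
      ∫⁻ x in Set.Ioi 0, ((fun x : ℝ => |x|) ⁻¹' s).indicator
        (fun a => ENNReal.ofReal (g σ a)) x := by
    have mp := (Measure.measurePreserving_neg (volume : Measure ℝ))
    rw [← mp.setLIntegral_comp_preimage_emb (MeasurableEquiv.neg ℝ).measurableEmbedding _
      (Set.Iio 0)]
    simp only [Set.neg_preimage, Set.neg_Iio, neg_zero]
    refine lintegral_congr fun x => ?_
    simp only [Set.indicator, Set.mem_preimage, abs_neg, hneg]
  rw [h2, ← two_mul, ← lintegral_indicator measurableSet_Ioi, ← lintegral_const_mul _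
    ((Measurable.indicator (by fun_prop) (habs hs)).indicator measurableSet_Ioi)]
  refine lintegral_congr fun x => ?_
  by_cases hx : 0 < x
  · by_cases hxs : x ∈ s
    · simp [Set.indicator, hx, hxs, abs_of_pos hx, hg]
    · simp [Set.indicator, hx, hxs, abs_of_pos hx]
  · simp [Set.indicator, hx]

/-- The norm of a vector of `m` independent noise components. -/
lemma map_norm_pi_noiseLaw {m : ℕ} (hm : 1 ≤ m) {σ : ℝ} (hσ : 0 < σ) :
    (Measure.pi (fun _ : Fin m => noiseLaw σ)).map (fun x => Real.sqrt (∑ i, x i ^ 2)) =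
      chiLaw m σ := by
  induction m, hm using Nat.le_induction with
  | base =>
    have mp := measurePreserving_eval (μ := fun _ : Fin 1 => noiseLaw σ) 0
    rw [← map_abs_noiseLaw hσ]
    conv_rhs => rw [← mp.map_eq]
    rw [Measure.map_map continuous_abs.measurable (by fun_prop)]
    congr 1; ext x
    simp [Real.sqrt_sq_eq_abs]
  | succ m hm ih =>
    have h1 := isProbabilityMeasure_chiLaw hm hσ
    have mp := measurePreserving_piFinSuccAbove (fun _ : Fin (m + 1) => noiseLaw σ) 0
    rw [← map_norm_prod_chiLaw hm hσ, ← ih]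
    conv_rhs => enter [2, 1]; rw [← Measure.map_id (μ := noiseLaw σ)]
    rw [Measure.map_prod_map _ _ measurable_id (by fun_prop), Measure.map_map (by fun_prop)
      (by fun_prop)]
    rw [← mp.map_eq, Measure.map_map (by fun_prop) (by fun_prop)]
    congr 1; ext x
    simp only [Function.comp, MeasurableEquiv.piFinSuccAbove_apply, Fin.insertNthEquiv_zero,
      Fin.consEquiv_symm_apply, Prod.map, id]
    rw [Real.sq_sqrt (by positivity), Fin.sum_univ_succ]
    rfl

/-! ### Orthogonal components of the noise -/

lemma awgn_eq_map_pi {n : ℕ} (σ : ℝ) (b : OrthonormalBasis (Fin n) ℝ (Sig n)) :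
    awgn n σ = (Measure.pi (fun _ : Fin n => noiseLaw σ)).map (fun x => ∑ i, x i • b i) := by
  have h : noiseLaw σ = (gaussianReal 0 1).map (fun x => σ * x) := by
    rw [gaussianReal_map_const_mul, noiseLaw]
    congr 1
    · simp
    · ext; simp [Real.coe_toNNReal _ (sq_nonneg σ)]
  rw [awgn, stdGaussian_eq_map_pi_orthonormalBasis b, Measure.map_map (by fun_prop) (by fun_prop)]
  have hp : Measure.pi (fun _ : Fin n => noiseLaw σ) =
      (Measure.pi (fun _ : Fin n => gaussianReal 0 1)).map (fun x i => σ * x i) := by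
    rw [h, ← Measure.pi_map_pi]
    fun_prop
  rw [hp, Measure.map_map (by fun_prop) (by fun_prop)]
  congr 1; ext1 x
  simp [Function.comp, Finset.smul_sum, mul_smul]

/-- The norm and the first coordinate of a noise vector of dimension at least two. -/
lemma map_norm_coord_pi_noiseLaw {m : ℕ} (hm : 1 ≤ m) {σ : ℝ} (hσ : 0 < σ) :
    (Measure.pi (fun _ : Fin (m + 1) => noiseLaw σ)).map
        (fun y => (Real.sqrt (∑ i, y i ^ 2), y 0)) =
      ((chiLaw (m + 1) σ).prod (angleLaw m)).map (fun p => (p.1, p.1 * Real.cos p.2)) := by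
  have h1 := isProbabilityMeasure_chiLaw hm hσ
  have h2 := isProbabilityMeasure_angleLaw hm
  have mp := measurePreserving_piFinSuccAbove (fun _ : Fin (m + 1) => noiseLaw σ) 0
  have hF : Measurable (fun q : ℝ × ℝ => (Real.sqrt (q.1 ^ 2 + q.2 ^ 2), q.1)) := by fun_prop
  have e1 : (Measure.pi (fun _ : Fin (m + 1) => noiseLaw σ)).map
      (fun y => (y 0, Real.sqrt (∑ i : Fin m, y i.succ ^ 2))) =
      (noiseLaw σ).prod (chiLaw m σ) := by
    rw [← map_norm_pi_noiseLaw hm hσ]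
    conv_rhs => enter [1]; rw [← Measure.map_id (μ := noiseLaw σ)]
    rw [Measure.map_prod_map _ _ measurable_id (by fun_prop), ← mp.map_eq,
      Measure.map_map (by fun_prop) (by fun_prop)]
    rfl
  have e2 := congrArg (Measure.map fun q : ℝ × ℝ => (Real.sqrt (q.1 ^ 2 + q.2 ^ 2), q.1)) e1
  rw [polar_pushforward hm hσ, Measure.map_map hF (by fun_prop),
    Measure.map_map hF (by fun_prop)] at e2
  convert e2 using 1
  · congr 1; ext1 y
    simp only [Function.comp]
    rw [Real.sq_sqrt (by positivity), Fin.sum_univ_succ]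
  · refine Measure.map_congr ?_
    have : ∀ᵐ p ∂((chiLaw (m + 1) σ).prod (angleLaw m)), 0 < p.1 :=
      Measure.quasiMeasurePreserving_fst.ae (ae_pos_chiLaw (m + 1) σ)
    filter_upwards [this] with p hp
    simp only [Function.comp]
    rw [show (p.1 * Real.cos p.2) ^ 2 + (p.1 * Real.sin p.2) ^ 2 = p.1 ^ 2 by
      rw [mul_pow, mul_pow, Real.cos_sq']; ring, Real.sqrt_sq hp.le]

/-- For orthonormal `u` and `e`: the joint law of the `u`-component of the noise, of the norm of
the part orthogonal to `u`, and of the `e`-component. -/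
lemma map_awgn_components {m : ℕ} (hm : 1 ≤ m) {σ : ℝ} (hσ : 0 < σ) {u e : Sig (m + 2)}
    (hu : ‖u‖ = 1) (he : ‖e‖ = 1) (hue : inner ℝ u e = 0) :
    (awgn (m + 2) σ).map
        (fun w => (inner ℝ w u, (‖w - (inner ℝ w u : ℝ) • u‖, (inner ℝ w e : ℝ)))) =
      ((noiseLaw σ).prod ((chiLaw (m + 1) σ).prod (angleLaw m))).map
        (fun p => (p.1, (p.2.1, p.2.1 * Real.cos p.2.2))) := by
  have h1 := isProbabilityMeasure_chiLaw (Nat.le_add_left 1 m) hσ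
  have h2 := isProbabilityMeasure_angleLaw hm
  have hon : Orthonormal ℝ (({0, 1} : Set (Fin (m + 2))).domRestrict
      (Fin.cons u (Fin.cons e (fun _ => 0)) : Fin (m + 2) → Sig (m + 2))) := by
    constructor
    · rintro ⟨i, rfl | rfl⟩
      · exact hu
      · exact he
    · rintro ⟨i, rfl | rfl⟩ ⟨j, rfl | rfl⟩ hij
      · exact absurd rfl hij
      · exact hue
      · exact (real_inner_comm _ _).trans hue
      · exact absurd rfl hij
  obtain ⟨b, hb⟩ := hon.exists_orthonormalBasis_extension_of_card_eq (by simp)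
  have hb0 : b 0 = u := hb 0 (by simp)
  have hb1 : b 1 = e := hb 1 (by simp)
  have hin : ∀ (x : Fin (m + 2) → ℝ) j, inner ℝ (∑ i, x i • b i) (b j) = x j := fun x j => by
    simpa using b.orthonormal.inner_left_fintype x j
  have hnorm : ∀ (x : Fin (m + 2) → ℝ), ‖(∑ i, x i • b i) - x 0 • b 0‖ =
      Real.sqrt (∑ i : Fin (m + 1), x i.succ ^ 2) := fun x => by
    rw [Fin.sum_univ_succ, add_sub_cancel_left, norm_eq_sqrt_real_inner]
    congr 1
    have := (b.orthonormal.comp _ (Fin.succ_injective (m + 1))).inner_sum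
      (fun i => x i.succ) (fun i => x i.succ) Finset.univ
    simpa [Function.comp, pow_two] using this
  rw [awgn_eq_map_pi σ b, Measure.map_map (by fun_prop) (by fun_prop)]
  have hc : ((fun w : Sig (m + 2) => (inner ℝ w u, (‖w - (inner ℝ w u : ℝ) • u‖,
      (inner ℝ w e : ℝ)))) ∘ fun x : Fin (m + 2) → ℝ => ∑ i, x i • b i) =
      Prod.map id (fun y : Fin (m + 1) → ℝ => (Real.sqrt (∑ i, y i ^ 2), y 0)) ∘
        MeasurableEquiv.piFinSuccAbove (fun _ : Fin (m + 2) => ℝ) 0 := by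
    ext1 x
    simp only [Function.comp, ← hb0, ← hb1, hin, hnorm]
    rfl
  have mp := measurePreserving_piFinSuccAbove (fun _ : Fin (m + 2) => noiseLaw σ) 0
  rw [hc, ← Measure.map_map (by fun_prop) (MeasurableEquiv.measurable _), mp.map_eq,
    ← Measure.map_prod_map _ _ measurable_id (by fun_prop), map_norm_coord_pi_noiseLaw hm hσ,
    Measure.map_prod_map _ _ measurable_id (by fun_prop)]
  rfl

/-! ### Spherical caps -/

/-- The angular law of the spherical cap with `x ≤ cos φ`. -/
lemma angleLaw_cap {m : ℕ} (hm : 1 ≤ m) (x : ℝ) :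
    angleLaw m {φ | x ≤ Real.cos φ} = ENNReal.ofReal (capRatio (m + 2) x) := by
  have hms : MeasurableSet {φ | x ≤ Real.cos φ} :=
    measurableSet_le measurable_const Real.measurable_cos
  rw [angleLaw, withDensity_apply _ hms, Measure.restrict_restrict hms, capRatio_add_two,
    ← intervalIntegral.integral_const_mul,
    intervalIntegral.integral_of_le (Real.arccos_nonneg x),
    ofReal_integral_eq_lintegral_ofReal]
  · refine setLIntegral_congr ?_
    -- the two sets agree on `(0, π)` up to the endpoint `π`
    have hπ : ∀ᵐ φ : ℝ, φ ≠ Real.pi := by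
      simp [ae_iff]
    filter_upwards [hπ] with φ hφ
    refine propext ?_
    change (x ≤ Real.cos φ ∧ 0 < φ ∧ φ < Real.pi) ↔ (0 < φ ∧ φ ≤ Real.arccos x)
    constructor
    · rintro ⟨h1, h2, h3⟩
      refine ⟨h2, ?_⟩
      rw [← Real.arccos_cos h2.le h3.le]
      exact Real.arccos_le_arccos h1
    · rintro ⟨h1, h2⟩
      have h3 : φ < Real.pi := lt_of_le_of_ne (h2.trans (Real.arccos_le_pi x)) hφ
      refine ⟨?_, h1, h3⟩
      by_cases hx : x ≤ -1
      · exact hx.trans (Real.neg_one_le_cos φ)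
      by_cases hx1 : 1 ≤ x
      · rw [Real.arccos_of_one_le hx1] at h2; linarith
      rw [← Real.cos_arccos (by linarith : -1 ≤ x) (by linarith)]
      exact Real.cos_le_cos_of_nonneg_of_le_pi h1.le (Real.arccos_le_pi x) h2
  · exact (by fun_prop : Continuous fun φ => angleConst m * Real.sin φ ^ (m - 1)).integrableOn_Ioc
  · filter_upwards [ae_restrict_mem measurableSet_Ioc] with φ hφ
    have : 0 ≤ Real.sin φ := Real.sin_nonneg_of_nonneg_of_le_pi hφ.1.le
      (hφ.2.trans (Real.arccos_le_pi x))
    have := angleConst_pos hm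
    positivity

lemma capRatio_nonneg {m : ℕ} (hm : 1 ≤ m) (x : ℝ) : 0 ≤ capRatio (m + 2) x := by
  rw [capRatio_add_two]
  have := angleConst_pos hm
  refine mul_nonneg this.le (intervalIntegral.integral_nonneg (Real.arccos_nonneg x) fun φ hφ => ?_)
  exact pow_nonneg (Real.sin_nonneg_of_nonneg_of_le_pi hφ.1 (hφ.2.trans (Real.arccos_le_pi x))) _

lemma capRatio_of_one_le {n : ℕ} {x : ℝ} (hx : 1 ≤ x) : capRatio n x = 0 := by
  simp [capRatio, Real.arccos_of_one_le hx]

lemma angleConst_mul_integral {m : ℕ} (hm : 1 ≤ m) :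
    angleConst m * ∫ φ in (0 : ℝ)..Real.pi, Real.sin φ ^ (m - 1) = 1 := by
  have h := isProbabilityMeasure_angleLaw hm
  have h1 := angleLaw_cap hm (-1)
  have h2 : {φ | -1 ≤ Real.cos φ} = Set.univ := by ext φ; simp [Real.neg_one_le_cos]
  rw [h2, measure_univ, capRatio_add_two, Real.arccos_neg_one] at h1
  exact (ENNReal.ofReal_eq_one.1 h1.symm)

/-- A hyperplane through the centre halves the sphere. -/
lemma capRatio_zero {m : ℕ} (hm : 1 ≤ m) : capRatio (m + 2) 0 = 1 / 2 := by
  have h1 := angleConst_mul_integral hm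
  have hint : ∀ a b, IntervalIntegrable (fun φ => Real.sin φ ^ (m - 1)) volume a b :=
    fun a b => (by fun_prop : Continuous fun φ => Real.sin φ ^ (m - 1)).intervalIntegrable a b
  have h2 : ∫ φ in (Real.pi / 2)..Real.pi, Real.sin φ ^ (m - 1) =
      ∫ φ in (0 : ℝ)..(Real.pi / 2), Real.sin φ ^ (m - 1) := by
    have := intervalIntegral.integral_comp_sub_left (fun φ => Real.sin φ ^ (m - 1)) Real.pi
      (a := 0) (b := Real.pi / 2)
    simp only [Real.sin_pi_sub, sub_zero] at this
    rw [this]; congr 1; ring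
  rw [← intervalIntegral.integral_add_adjacent_intervals (hint 0 (Real.pi / 2)) (hint _ _), h2]
    at h1
  rw [capRatio_add_two, Real.arccos_zero]
  linarith

lemma capRatio_strictAntiOn {m : ℕ} (hm : 1 ≤ m) :
    StrictAntiOn (capRatio (m + 2)) (Set.Icc (-1) 1) := by
  intro x hx y hy hxy
  have h := Real.strictAntiOn_arccos hx hy hxy
  rw [capRatio_add_two, capRatio_add_two]
  refine mul_lt_mul_of_pos_left ?_ (angleConst_pos hm)
  have hint : ∀ a b, IntervalIntegrable (fun φ => Real.sin φ ^ (m - 1)) volume a b :=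
    fun a b => (by fun_prop : Continuous fun φ => Real.sin φ ^ (m - 1)).intervalIntegrable a b
  rw [← intervalIntegral.integral_add_adjacent_intervals (hint 0 (Real.arccos y))
    (hint _ (Real.arccos x))]
  refine lt_add_of_pos_right _ (intervalIntegral.intervalIntegral_pos_of_pos_on (hint _ _) ?_ h)
  intro φ hφ
  exact pow_pos (Real.sin_pos_of_pos_of_lt_pi ((Real.arccos_nonneg y).trans_lt hφ.1)
    (hφ.2.trans_le (Real.arccos_le_pi x))) _

lemma capRatio_antitone {m : ℕ} (hm : 1 ≤ m) : Antitone (capRatio (m + 2)) := by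
  intro x y hxy
  have h1 := angleLaw_cap hm x
  have h2 := angleLaw_cap hm y
  rw [← ENNReal.ofReal_le_ofReal_iff (capRatio_nonneg hm x), ← h1, ← h2]
  exact measure_mono fun φ (hφ : y ≤ Real.cos φ) => hxy.trans hφ

lemma continuous_capRatio (n : ℕ) : Continuous (capRatio n) := by
  unfold capRatio
  refine continuous_const.mul ?_
  have h : Continuous fun x => ∫ φ in (0 : ℝ)..x, Real.sin φ ^ (n - 3) :=
    intervalIntegral.continuous_primitive (fun a b =>
      (by fun_prop : Continuous fun φ => Real.sin φ ^ (n - 3)).intervalIntegrable a b) 0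
  exact h.comp Real.continuous_arccos

lemma capRatio_le_half {m : ℕ} (hm : 1 ≤ m) {x : ℝ} (h0 : 0 ≤ x) : capRatio (m + 2) x ≤ 1 / 2 := by
  rw [← capRatio_zero hm]
  exact capRatio_antitone hm h0

lemma capRatio_lt_half {m : ℕ} (hm : 1 ≤ m) {x : ℝ} (h0 : 0 < x) : capRatio (m + 2) x < 1 / 2 := by
  rcases le_or_gt 1 x with h | h
  · rw [capRatio_of_one_le h]; norm_num
  · rw [← capRatio_zero hm]
    exact capRatio_strictAntiOn hm ⟨by norm_num, by norm_num⟩ ⟨by linarith, h.le⟩ h0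

/-! ### The conditional union bound of a linear code -/

/-- The pairwise error probability `p₂` of two bipolar words at Hamming distance `d`. -/
def pairError (n : ℕ) (d : ℕ) (z r : ℝ) : ℝ :=
  p₂ n z r (Real.sqrt n) (Real.sqrt n) (2 * Real.sqrt d)

/-- The nonzero codewords. -/
def nonzeroWords {n : ℕ} (C : Submodule (ZMod 2) (Fin n → ZMod 2)) : Finset (Fin n → ZMod 2) :=
  Finset.univ.filter (fun c => c ∈ C ∧ c ≠ 0)

lemma bpsk_mul_bpsk_apply (a b : ZMod 2) :
    (1 - 2 * (a.val : ℝ)) * (1 - 2 * (b.val : ℝ)) = 1 - 2 * (if a ≠ b then 1 else 0) := by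
  have h01 : (0 : ZMod 2) ≠ 1 := by decide
  have h0 : (0 : ZMod 2).val = 0 := rfl
  have h1 : (1 : ZMod 2).val = 1 := rfl
  have hc : ∀ x : ZMod 2, x = 0 ∨ x = 1 := by decide
  rcases hc a with rfl | rfl <;> rcases hc b with rfl | rfl <;>
    norm_num [h0, h1, h01, h01.symm]

lemma inner_bpsk {n : ℕ} (c c' : Fin n → ZMod 2) :
    inner ℝ (bpsk c) (bpsk c') = (n : ℝ) - 2 * hammingDist c c' := by
  rw [PiLp.inner_apply]
  simp only [bpsk, RCLike.inner_apply, conj_trivial, mul_comm (1 - 2 * ((c' _).val : ℝ))]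
  simp only [bpsk_mul_bpsk_apply, Finset.sum_sub_distrib, ← Finset.mul_sum, Finset.sum_boole]
  simp [hammingDist]

lemma norm_bpsk {n : ℕ} (c : Fin n → ZMod 2) : ‖bpsk c‖ = Real.sqrt n := by
  rw [norm_eq_sqrt_real_inner, inner_bpsk]; simp

lemma dist_bpsk {n : ℕ} (c c' : Fin n → ZMod 2) :
    dist (bpsk c) (bpsk c') = 2 * Real.sqrt (hammingDist c c') := by
  have h : dist (bpsk c) (bpsk c') ^ 2 = 4 * hammingDist c c' := by
    rw [dist_eq_norm, @norm_sub_sq_real, inner_bpsk, norm_bpsk, norm_bpsk,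
      Real.sq_sqrt (by positivity)]
    ring
  rw [← Real.sqrt_sq dist_nonneg, h, Real.sqrt_mul (by norm_num),
    show (4 : ℝ) = 2 ^ 2 by norm_num, Real.sqrt_sq (by norm_num)]

lemma bpsk_injective {n : ℕ} : Function.Injective (bpsk (n := n)) := by
  intro c c' h
  have h1 := dist_bpsk c c'
  rw [h, dist_self] at h1
  have h2 : Real.sqrt (hammingDist c c') = 0 := by linarith
  rw [Real.sqrt_eq_zero (by positivity)] at h2
  exact hammingDist_eq_zero.1 (by exact_mod_cast h2)

lemma fs_eq_sum {n : ℕ} (S : Finset (Sig n)) (z r : ℝ) (s : Sig n) :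
    fs S z r s = ∑ t ∈ S.erase s, p₂ n z r ‖s‖ ‖t‖ (dist t s) := by
  rw [fs, ← Finset.sum_fiberwise_of_maps_to (s := S.erase s)
    (g := fun t => (‖s‖, ‖t‖, dist t s)) (fun t ht => Finset.mem_image_of_mem
      (fun t => (‖s‖, ‖t‖, dist t s)) ht)]
  refine Finset.sum_congr rfl fun δ _ => ?_
  rw [triSpectrum, ← nsmul_eq_mul, ← Finset.sum_const]
  refine Finset.sum_congr ?_ fun t ht => ?_
  · ext t; simp [Prod.ext_iff]
  · obtain ⟨_, rfl⟩ := Finset.mem_filter.1 ht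
    rfl

lemma signals_erase {n : ℕ} (C : Submodule (ZMod 2) (Fin n → ZMod 2)) (c : Fin n → ZMod 2) :
    (signals C).erase (bpsk c) = (Finset.univ.filter (fun x => x ∈ C ∧ x ≠ c)).image bpsk := by
  ext t
  simp only [signals, Finset.mem_erase, Finset.mem_image, Finset.mem_filter, Finset.mem_univ,
    true_and]
  constructor
  · rintro ⟨h, x, hx, rfl⟩
    exact ⟨x, ⟨hx, fun h' => h (by rw [h'])⟩, rfl⟩
  · rintro ⟨x, ⟨hx, hxc⟩, rfl⟩
    exact ⟨fun h => hxc (bpsk_injective h), x, hx, rfl⟩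

/-- By linearity the conditional union bound is the same for all transmitted codewords. -/
lemma fs_signals {n : ℕ} (C : Submodule (ZMod 2) (Fin n → ZMod 2)) {c : Fin n → ZMod 2}
    (hc : c ∈ C) (z r : ℝ) :
    fs (signals C) z r (bpsk c) = ∑ x ∈ nonzeroWords C, pairError n (hammingNorm x) z r := by
  rw [fs_eq_sum, signals_erase, Finset.sum_image bpsk_injective.injOn]
  refine Finset.sum_bij (fun x _ => x - c) ?_ ?_ ?_ ?_
  · intro x hx
    simp only [Finset.mem_filter, Finset.mem_univ, true_and, nonzeroWords] at hx ⊢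
    exact ⟨C.sub_mem hx.1 hc, sub_ne_zero.2 hx.2⟩
  · intro x _ y _ h
    exact sub_left_injective h
  · intro y hy
    simp only [Finset.mem_filter, Finset.mem_univ, true_and, nonzeroWords] at hy ⊢
    exact ⟨y + c, ⟨C.add_mem hy.1 hc, by simpa using hy.2⟩, by simp⟩
  · intro x _
    rw [norm_bpsk, norm_bpsk, dist_bpsk, pairError, hammingDist_comm, hammingDist_eq_hammingNorm,
      neg_add_eq_sub]

lemma hammingNorm_le {n : ℕ} (x : Fin n → ZMod 2) : hammingNorm x ≤ n := by
  simpa using hammingNorm_le_card_fintype (x := x)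

lemma hammingNorm_eq_iff {n : ℕ} (x : Fin n → ZMod 2) : hammingNorm x = n ↔ x = 1 := by
  constructor
  · intro h
    have h2 : (Finset.univ.filter fun i => x i ≠ 0) = Finset.univ :=
      Finset.eq_univ_of_card _ (by simpa [hammingNorm] using h)
    ext1 i
    have h3 : x i ≠ 0 := by
      have := Finset.mem_univ i
      rw [← h2] at this
      simpa using this
    generalize x i = a at h3
    fin_cases a
    · exact absurd rfl h3
    · rfl
  · rintro rfl
    simp [hammingNorm]

lemma sum_nonzeroWords {n : ℕ} (C : Submodule (ZMod 2) (Fin n → ZMod 2)) (f : ℕ → ℝ) :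
    ∑ x ∈ nonzeroWords C, f (hammingNorm x) =
      ∑ d ∈ Finset.Icc 1 n, (weightCount C d : ℝ) * f d := by
  rw [← Finset.sum_fiberwise_of_maps_to (s := nonzeroWords C) (t := Finset.Icc 1 n)
    (g := fun x => hammingNorm x)]
  · refine Finset.sum_congr rfl fun d hd => ?_
    rw [weightCount, ← nsmul_eq_mul, ← Finset.sum_const]
    refine Finset.sum_congr ?_ fun t ht => ?_
    · ext x
      simp only [nonzeroWords, Finset.mem_filter, Finset.mem_univ, true_and]
      constructor
      · rintro ⟨⟨h1, h2⟩, h3⟩; exact ⟨h1, h3⟩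
      · rintro ⟨h1, h3⟩
        refine ⟨⟨h1, ?_⟩, h3⟩
        rintro rfl
        simp only [hammingNorm_zero] at h3
        have := (Finset.mem_Icc.1 hd).1
        omega
    · rw [(Finset.mem_filter.1 ht).2.2]
  · intro x hx
    simp only [nonzeroWords, Finset.mem_filter, Finset.mem_univ, true_and] at hx
    exact Finset.mem_Icc.2 ⟨hammingNorm_pos_iff.2 hx.2, hammingNorm_le x⟩

/-! ### The pairwise error probability -/

/-- The distance `β_d(z)` from the axis to the decision boundary in the hyperplane at `z`, for a
competitor at Hamming distance `d < n`; for `d = n` the division by zero makes it `0`. -/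
def boundary (n d : ℕ) (z : ℝ) : ℝ :=
  Real.sqrt d * (Real.sqrt n - z) / Real.sqrt ((n : ℝ) - d)

lemma theta_bpsk {n d : ℕ} (hd : 1 ≤ d) (hdn : d ≤ n) :
    theta (Real.sqrt n) (Real.sqrt n) (2 * Real.sqrt d) =
      Real.arccos (Real.sqrt d / Real.sqrt n) := by
  have h1 : (0 : ℝ) < d := by exact_mod_cast hd
  have h2 : (0 : ℝ) < n := by exact_mod_cast hd.trans hdn
  have h3 := Real.sqrt_pos.2 h1
  have h4 := Real.sqrt_pos.2 h2
  rw [theta]; congr 1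
  field_simp
  ring

lemma cos_theta_bpsk {n d : ℕ} (hd : 1 ≤ d) (hdn : d ≤ n) :
    Real.cos (theta (Real.sqrt n) (Real.sqrt n) (2 * Real.sqrt d)) =
      Real.sqrt d / Real.sqrt n := by
  have h2 : (0 : ℝ) < n := by exact_mod_cast hd.trans hdn
  rw [theta_bpsk hd hdn, Real.cos_arccos]
  · have : 0 ≤ Real.sqrt d / Real.sqrt n := by positivity
    linarith
  · rw [div_le_one (Real.sqrt_pos.2 h2)]
    exact Real.sqrt_le_sqrt (by exact_mod_cast hdn)

lemma sin_theta_bpsk {n d : ℕ} (hd : 1 ≤ d) (hdn : d ≤ n) :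
    Real.sin (theta (Real.sqrt n) (Real.sqrt n) (2 * Real.sqrt d)) =
      Real.sqrt ((n : ℝ) - d) / Real.sqrt n := by
  have h2 : (0 : ℝ) < n := by exact_mod_cast hd.trans hdn
  rw [theta_bpsk hd hdn, Real.sin_arccos, div_pow, Real.sq_sqrt (by positivity),
    Real.sq_sqrt h2.le, ← Real.sqrt_div' _ h2.le]
  congr 1
  field_simp

lemma sqrt_sub_pos {n d : ℕ} (hdn : d < n) : 0 < Real.sqrt ((n : ℝ) - d) :=
  Real.sqrt_pos.2 (sub_pos.2 (by exact_mod_cast hdn))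

lemma beta_bpsk {n d : ℕ} (hd : 1 ≤ d) (hdn : d < n) (z : ℝ) :
    beta z (Real.sqrt n) (Real.sqrt n) (2 * Real.sqrt d) = boundary n d z := by
  have h2 : (0 : ℝ) < n := by exact_mod_cast hd.trans hdn.le
  have h3 := Real.sqrt_pos.2 h2
  have h4 := sqrt_sub_pos hdn
  rw [beta, cos_theta_bpsk hd hdn.le, sin_theta_bpsk hd hdn.le, boundary]
  field_simp

lemma pairError_eq {n d : ℕ} (hd : 1 ≤ d) (hdn : d < n) (z r : ℝ) :
    pairError n d z r = if 0 < boundary n d z then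
        if boundary n d z ≤ r then capRatio n (boundary n d z / r) else 0
      else if |boundary n d z| ≤ r then 1 - capRatio n (|boundary n d z| / r) else 1 := by
  have h2 : (0 : ℝ) < n := by exact_mod_cast hd.trans hdn.le
  have h3 := Real.sqrt_pos.2 h2
  have h4 := sqrt_sub_pos hdn
  rw [pairError, p₂, if_neg, beta_bpsk hd hdn]
  rw [sin_theta_bpsk hd hdn.le]; positivity

lemma pairError_self {n : ℕ} (hn : 1 ≤ n) (z r : ℝ) :
    pairError n n z r = if z < Real.sqrt n then 0 else 1 := by
  have h2 : (0 : ℝ) < n := by exact_mod_cast hn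
  have h3 := Real.sqrt_pos.2 h2
  rw [pairError, p₂, if_pos (by simp [sin_theta_bpsk hn le_rfl]), cos_theta_bpsk hn le_rfl,
    div_self h3.ne']
  congr 1
  exact propext ⟨fun h => by linarith, fun h => by linarith⟩

lemma boundary_pos {n d : ℕ} (hd : 1 ≤ d) (hdn : d < n) {z : ℝ} (hz : z < Real.sqrt n) :
    0 < boundary n d z := by
  have h1 : (0 : ℝ) < d := by exact_mod_cast hd
  exact div_pos (mul_pos (Real.sqrt_pos.2 h1) (sub_pos.2 hz)) (sqrt_sub_pos hdn)

lemma boundary_nonpos {n d : ℕ} {z : ℝ} (hz : Real.sqrt n ≤ z) : boundary n d z ≤ 0 :=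
  div_nonpos_of_nonpos_of_nonneg
    (mul_nonpos_of_nonneg_of_nonpos (Real.sqrt_nonneg _) (by linarith)) (Real.sqrt_nonneg _)

lemma pairError_of_lt {n d : ℕ} (hd : 1 ≤ d) (hdn : d < n) {z r : ℝ} (hz : z < Real.sqrt n)
    (hr : 0 < r) : pairError n d z r = capRatio n (boundary n d z / r) := by
  rw [pairError_eq hd hdn, if_pos (boundary_pos hd hdn hz)]
  split_ifs with h
  · rfl
  · rw [capRatio_of_one_le]
    rw [le_div_iff₀ hr]; linarith

lemma half_le_pairError {m d : ℕ} (hm : 1 ≤ m) (hd : 1 ≤ d) (hdn : d ≤ m + 2) {z : ℝ}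
    (hz : Real.sqrt (m + 2 : ℕ) ≤ z) (r : ℝ) : 1 / 2 ≤ pairError (m + 2) d z r := by
  rcases hdn.eq_or_lt with rfl | hlt
  · rw [pairError_self hd, if_neg (not_lt.2 hz)]; norm_num
  · rw [pairError_eq hd hlt, if_neg (not_lt.2 (boundary_nonpos hz))]
    split_ifs with h
    · have := capRatio_le_half hm
        (div_nonneg (abs_nonneg (boundary (m + 2) d z)) ((abs_nonneg _).trans h))
      linarith
    · norm_num

lemma pairError_nonneg {m d : ℕ} (hm : 1 ≤ m) (hd : 1 ≤ d) (hdn : d ≤ m + 2) (z r : ℝ) :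
    0 ≤ pairError (m + 2) d z r := by
  rcases le_or_gt (Real.sqrt (m + 2 : ℕ)) z with hz | hz
  · have := half_le_pairError hm hd hdn hz r; linarith
  rcases hdn.eq_or_lt with rfl | hlt
  · rw [pairError_self hd]; split_ifs <;> norm_num
  · rw [pairError_eq hd hlt, if_pos (boundary_pos hd hlt hz)]
    split_ifs
    · exact capRatio_nonneg hm _
    · rfl

lemma pairError_le_one {m d : ℕ} (hm : 1 ≤ m) (hd : 1 ≤ d) (hdn : d ≤ m + 2) (z r : ℝ) :
    pairError (m + 2) d z r ≤ 1 := by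
  rcases hdn.eq_or_lt with rfl | hlt
  · rw [pairError_self hd]; split_ifs <;> norm_num
  · rw [pairError_eq hd hlt]
    split_ifs with h1 h2 h2
    · have := capRatio_le_half hm (div_nonneg h1.le (h1.le.trans h2))
      linarith
    · norm_num
    · have := capRatio_nonneg hm (|boundary (m + 2) d z| / r)
      linarith
    · rfl

lemma continuous_boundary (n d : ℕ) : Continuous (boundary n d) := by
  unfold boundary; fun_prop

lemma measurable_pairError (n d : ℕ) (hd : 1 ≤ d) (hdn : d ≤ n) :
    Measurable (fun p : ℝ × ℝ => pairError n d p.1 p.2) := by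
  have hb : Measurable (fun p : ℝ × ℝ => boundary n d p.1) :=
    (continuous_boundary n d).measurable.comp measurable_fst
  have hb' : Measurable (fun p : ℝ × ℝ => |boundary n d p.1|) :=
    continuous_abs.measurable.comp hb
  have hcap := (continuous_capRatio n).measurable
  rcases hdn.eq_or_lt with rfl | hlt
  · simp only [pairError_self hd]
    exact Measurable.ite (measurableSet_lt measurable_fst measurable_const) measurable_const
      measurable_const
  · simp only [pairError_eq hd hlt]
    refine Measurable.ite (measurableSet_lt measurable_const hb) ?_ ?_
    · exact Measurable.ite (measurableSet_le hb measurable_snd)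
        (hcap.comp (hb.div measurable_snd)) measurable_const
    · exact Measurable.ite (measurableSet_le hb' measurable_snd)
        (measurable_const.sub (hcap.comp (hb'.div measurable_snd))) measurable_const

/-! ### The law of the radial and tangential noise and the pairwise error events -/

/-- The joint law of the radial component and of the tangential norm of the noise in dimension
`m + 2`. -/
def polarLaw (m : ℕ) (σ : ℝ) : Measure (ℝ × ℝ) := (noiseLaw σ).prod (chiLaw (m + 1) σ)

lemma isProbabilityMeasure_polarLaw (m : ℕ) {σ : ℝ} (hσ : 0 < σ) :
    IsProbabilityMeasure (polarLaw m σ) := by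
  have := isProbabilityMeasure_chiLaw (Nat.le_add_left 1 m) hσ
  unfold polarLaw; infer_instance

lemma ae_pos_polarLaw (m : ℕ) (σ : ℝ) : ∀ᵐ p ∂(polarLaw m σ), 0 < p.2 :=
  Measure.quasiMeasurePreserving_snd.ae (ae_pos_chiLaw (m + 1) σ)

lemma norm_axis {n : ℕ} {s : Sig n} (hs : s ≠ 0) : ‖-(‖s‖⁻¹ • s)‖ = 1 := by
  rw [norm_neg, norm_smul, norm_inv, norm_norm, inv_mul_cancel₀ (norm_ne_zero_iff.2 hs)]

@[fun_prop]
lemma continuous_radial {n : ℕ} (s : Sig n) : Continuous (radial s) := by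
  unfold radial; fun_prop

@[fun_prop]
lemma continuous_tangential {n : ℕ} (s : Sig n) : Continuous (tangential s) := by
  unfold tangential; fun_prop

lemma map_radial_tangential {m : ℕ} (hm : 1 ≤ m) {σ : ℝ} (hσ : 0 < σ) {s : Sig (m + 2)}
    (hs : s ≠ 0) :
    (awgn (m + 2) σ).map (fun w => (radial s w, tangential s w)) = polarLaw m σ := by
  have h1 := isProbabilityMeasure_chiLaw (Nat.le_add_left 1 m) hσ
  have h2 := isProbabilityMeasure_angleLaw hm
  set u : Sig (m + 2) := -(‖s‖⁻¹ • s) with hu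
  have hu1 : ‖u‖ = 1 := norm_axis hs
  -- Any unit vector orthogonal to the axis serves as the second basis vector.
  obtain ⟨e, he1, hue⟩ : ∃ e : Sig (m + 2), ‖e‖ = 1 ∧ inner ℝ u e = 0 := by
    have : Nontrivial (Submodule.span ℝ {u})ᗮ := by
      have : Fact (Module.finrank ℝ (Sig (m + 2)) = m + 1 + 1) := ⟨by simp⟩
      have hf := Submodule.finrank_orthogonal_span_singleton (𝕜 := ℝ) (E := Sig (m + 2))
        (n := m + 1) (v := u) (by rw [← norm_ne_zero_iff, hu1]; norm_num)
      exact Module.nontrivial_of_finrank_pos (R := ℝ) (by omega)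
    obtain ⟨x, hx⟩ := exists_ne (0 : (Submodule.span ℝ {u})ᗮ)
    have hx0 : (x : Sig (m + 2)) ≠ 0 := fun h => hx (Subtype.ext h)
    refine ⟨-(‖(x : Sig (m + 2))‖⁻¹ • (x : Sig (m + 2))), norm_axis hx0, ?_⟩
    rw [inner_neg_right, inner_smul_right,
      Submodule.mem_orthogonal_singleton_iff_inner_right.1 x.2]
    simp
  have h := congrArg (Measure.map fun q : ℝ × ℝ × ℝ => (q.1, q.2.1))
    (map_awgn_components hm hσ hu1 he1 hue)
  rw [Measure.map_map (by fun_prop) (by fun_prop), Measure.map_map (by fun_prop) (by fun_prop)] at h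
  refine h.trans ?_
  have : ((noiseLaw σ).prod ((chiLaw (m + 1) σ).prod (angleLaw m))).map (Prod.map id Prod.fst) =
      polarLaw m σ := by
    rw [← Measure.map_prod_map _ _ measurable_id measurable_fst, Measure.map_id]
    simp [polarLaw]
  exact this

/-- The component of `t - s` along the axis `-s/‖s‖`. -/
lemma inner_bpsk_sub_axis {n : ℕ} (hn : 1 ≤ n) (c c' : Fin n → ZMod 2) :
    inner ℝ (bpsk c' - bpsk c) (-(‖bpsk c‖⁻¹ • bpsk c)) =
      2 * (hammingDist c' c : ℝ) / Real.sqrt n := by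
  have h2 : (0 : ℝ) < n := by exact_mod_cast hn
  have h3 := Real.sqrt_pos.2 h2
  have h4 := Real.sq_sqrt h2.le
  rw [inner_neg_right, inner_smul_right, inner_sub_left, inner_bpsk, inner_bpsk, norm_bpsk,
    hammingDist_self]
  field_simp
  push_cast
  ring

lemma dist_le_iff_inner {n : ℕ} (s t w : Sig n) :
    dist (s + w) t ≤ dist (s + w) s ↔ ‖t - s‖ ^ 2 ≤ 2 * inner ℝ w (t - s) := by
  rw [dist_eq_norm, dist_eq_norm, ← sq_le_sq₀ (norm_nonneg _) (norm_nonneg _),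
    show s + w - t = w - (t - s) by abel, @norm_sub_sq_real, add_sub_cancel_left]
  constructor <;> intro h <;> linarith

/-- Integrating out the angle turns the half-space `b z ≤ ρ cos φ` into a cap ratio. -/
lemma prod_prod_angleLaw_cap {m : ℕ} (hm : 1 ≤ m) (σ : ℝ) {b : ℝ → ℝ} (hb : Measurable b)
    {B : Set (ℝ × ℝ)} (hB : MeasurableSet B) :
    ((noiseLaw σ).prod ((chiLaw (m + 1) σ).prod (angleLaw m)))
        {q | (q.1, q.2.1) ∈ B ∧ b q.1 ≤ q.2.1 * Real.cos q.2.2} =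
      ∫⁻ p in B, ENNReal.ofReal (capRatio (m + 2) (b p.1 / p.2)) ∂(polarLaw m σ) := by
  have hms : MeasurableSet {q : ℝ × ℝ × ℝ | (q.1, q.2.1) ∈ B ∧
      b q.1 ≤ q.2.1 * Real.cos q.2.2} :=
    (hB.preimage (by fun_prop : Measurable fun q : ℝ × ℝ × ℝ => (q.1, q.2.1))).inter
      (measurableSet_le (hb.comp measurable_fst) (by fun_prop))
  rw [← Measure.prodAssoc_prod, Measure.map_apply (MeasurableEquiv.measurable _) hms,
    Measure.prod_apply (hms.preimage (MeasurableEquiv.measurable _)), ← lintegral_indicator hB]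
  refine lintegral_congr_ae ?_
  filter_upwards [ae_pos_polarLaw m σ] with p hp
  by_cases hpB : p ∈ B
  · rw [Set.indicator_of_mem hpB, ← angleLaw_cap hm]
    congr 1; ext φ
    simp [MeasurableEquiv.prodAssoc, hpB, div_le_iff₀' hp]
  · rw [Set.indicator_of_notMem hpB]
    convert measure_empty (μ := angleLaw m)
    ext φ
    simp [MeasurableEquiv.prodAssoc, hpB]

/-- The pairwise error event is a half-space condition. For `d < n` it bounds below the component
of the noise along the unit vector `e`, the direction of the competitor in the hyperplane orthogonal
to `s`; for `d = n` the competitor is `-s` and only the radial component matters. -/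
lemma pairwise_event_iff {n : ℕ} {c c' : Fin n → ZMod 2} (hcc : c' ≠ c) :
    (hammingDist c' c = n → ∀ w, dist (bpsk c + w) (bpsk c') ≤ dist (bpsk c + w) (bpsk c) ↔
      Real.sqrt n ≤ radial (bpsk c) w) ∧
    (hammingDist c' c < n → ∃ e : Sig n, ‖e‖ = 1 ∧ inner ℝ (-(‖bpsk c‖⁻¹ • bpsk c)) e = 0 ∧
      ∀ w, dist (bpsk c + w) (bpsk c') ≤ dist (bpsk c + w) (bpsk c) ↔
        boundary n (hammingDist c' c) (radial (bpsk c) w) ≤ inner ℝ w e) := by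
  set d := hammingDist c' c with hd
  have hd1 : 1 ≤ d := hammingDist_pos.2 hcc
  have hdn : d ≤ n := by simpa using hammingDist_le_card_fintype (x := c') (y := c)
  have hn0 : (0 : ℝ) < n := by exact_mod_cast hd1.trans hdn
  have hd0 : (0 : ℝ) < d := by exact_mod_cast hd1
  have hsn := Real.sqrt_pos.2 hn0
  have hsd := Real.sqrt_pos.2 hd0
  have hsn2 := Real.sq_sqrt hn0.le
  have hsd2 := Real.sq_sqrt hd0.le
  set s := bpsk c
  set t := bpsk c'
  have hs0 : s ≠ 0 := by
    rw [← norm_ne_zero_iff, norm_bpsk]; exact hsn.ne'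
  set u : Sig n := -(‖s‖⁻¹ • s) with hu
  have hu1 : ‖u‖ = 1 := norm_axis hs0
  have hts : ‖t - s‖ ^ 2 = 4 * d := by
    rw [← dist_eq_norm, dist_bpsk, mul_pow, ← hd, hsd2]; ring
  have htu : inner ℝ (t - s) u = 2 * (d : ℝ) / Real.sqrt n :=
    inner_bpsk_sub_axis (by omega) c c'
  -- `v` is the part of `t - s` orthogonal to the axis; it vanishes iff `d = n`.
  set v : Sig n := t - s - (2 * (d : ℝ) / Real.sqrt n) • u with hv
  have huu : inner ℝ u u = (1 : ℝ) := by rw [real_inner_self_eq_norm_sq, hu1]; norm_num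
  have huv : inner ℝ u v = 0 := by
    rw [hv, inner_sub_right, inner_smul_right, real_inner_comm, htu, huu]; ring
  have hdec : t - s = (2 * (d : ℝ) / Real.sqrt n) • u + v := by rw [hv]; abel
  have hvn : ‖v‖ ^ 2 = 4 * d * (n - d) / n := by
    have h := hts
    rw [hdec, @norm_add_sq_real, inner_smul_left, huv, norm_smul, hu1, mul_one, Real.norm_eq_abs,
      sq_abs, div_pow, hsn2] at h
    have : ‖v‖ ^ 2 = 4 * d - (2 * (d : ℝ)) ^ 2 / n := by
      simp only [mul_zero, add_zero] at h; linarith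
    rw [this]; field_simp; ring
  have hev : ∀ w, dist (s + w) t ≤ dist (s + w) s ↔
      2 * (d : ℝ) ≤ 2 * d / Real.sqrt n * radial s w + inner ℝ w v := by
    intro w
    rw [dist_le_iff_inner, hts, hdec, inner_add_right, inner_smul_right]
    change _ ≤ 2 * (_ * radial s w + _) ↔ _
    constructor <;> intro h <;> linarith
  constructor
  · intro hdn'
    have hv0 : v = 0 := by
      rw [← norm_eq_zero, ← sq_eq_zero_iff, hvn, hdn']; simp
    intro w
    rw [hev, hv0, inner_zero_right, add_zero, div_mul_eq_mul_div, le_div_iff₀ hsn,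
      mul_le_mul_iff_right₀ (by positivity)]
  · intro hlt
    have hnd := sqrt_sub_pos hlt
    have hnd2 : Real.sqrt ((n : ℝ) - d) ^ 2 = n - d :=
      Real.sq_sqrt (sub_nonneg.2 (by exact_mod_cast hlt.le))
    have hvτ : ‖v‖ = 2 * Real.sqrt d * Real.sqrt ((n : ℝ) - d) / Real.sqrt n := by
      rw [← sq_eq_sq₀ (norm_nonneg _) (by positivity), hvn, div_pow, mul_pow, mul_pow, hsd2, hnd2,
        hsn2]
      ring
    have hv0 : v ≠ 0 := by rw [← norm_ne_zero_iff, hvτ]; positivity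
    refine ⟨‖v‖⁻¹ • v, ?_, ?_, ?_⟩
    · rw [norm_smul, norm_inv, norm_norm, inv_mul_cancel₀ (norm_ne_zero_iff.2 hv0)]
    · rw [inner_smul_right, huv, mul_zero]
    · intro w
      have hve : inner ℝ w v = ‖v‖ * inner ℝ w (‖v‖⁻¹ • v) := by
        rw [inner_smul_right, mul_inv_cancel_left₀ (norm_ne_zero_iff.2 hv0)]
      rw [hev, hve, hvτ, boundary, div_le_iff₀ hnd, ← sub_nonneg,
        ← sub_nonneg (b := Real.sqrt d * _)]
      generalize inner ℝ w _ = x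
      have hd2 : (d : ℝ) = Real.sqrt d * Real.sqrt d := by rw [← pow_two, hsd2]
      have : 2 * (d : ℝ) / Real.sqrt n * radial s w + 2 * Real.sqrt d * Real.sqrt ((n : ℝ) - d) /
          Real.sqrt n * x - 2 * d = (2 * Real.sqrt d / Real.sqrt n) *
          (x * Real.sqrt ((n : ℝ) - d) - Real.sqrt d * (Real.sqrt n - radial s w)) := by
        have : ∀ a b y : ℝ, a ≠ 0 → 2 * (b * b) / a * radial s w + 2 * b * y / a * x - 2 * (b * b) =
            (2 * b / a) * (x * y - b * (a - radial s w)) := by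
          intro a b y ha; field_simp; ring
        have := this (Real.sqrt n) (Real.sqrt d) (Real.sqrt ((n : ℝ) - d)) hsn.ne'
        rwa [← hd2] at this
      rw [this, mul_nonneg_iff_of_pos_left (by positivity)]

/-- For `Z < √n`, `p₂` is the conditional probability that the received vector is at least as close
to the competitor as to the transmitted signal. -/
lemma awgn_pairwise_event {m : ℕ} (hm : 1 ≤ m) {σ : ℝ} (hσ : 0 < σ) {c c' : Fin (m + 2) → ZMod 2}
    (hcc : c' ≠ c) {B : Set (ℝ × ℝ)} (hB : MeasurableSet B)
    (hBz : ∀ p ∈ B, p.1 < Real.sqrt (m + 2 : ℕ)) :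
    awgn (m + 2) σ {w | (radial (bpsk c) w, tangential (bpsk c) w) ∈ B ∧
        dist (bpsk c + w) (bpsk c') ≤ dist (bpsk c + w) (bpsk c)} =
      ∫⁻ p in B, ENNReal.ofReal (pairError (m + 2) (hammingDist c' c) p.1 p.2) ∂(polarLaw m σ) := by
  have hd1 : 1 ≤ hammingDist c' c := hammingDist_pos.2 hcc
  have hdn : hammingDist c' c ≤ m + 2 := by
    simpa using hammingDist_le_card_fintype (x := c') (y := c)
  have hs0 : bpsk c ≠ 0 := by
    rw [← norm_ne_zero_iff, norm_bpsk]; positivity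
  obtain ⟨hself, hlt⟩ := pairwise_event_iff hcc
  generalize hammingDist c' c = d at *
  rcases hdn.eq_or_lt with hdn' | hlt'
  · have h1 : {w | (radial (bpsk c) w, tangential (bpsk c) w) ∈ B ∧
        dist (bpsk c + w) (bpsk c') ≤ dist (bpsk c + w) (bpsk c)} = ∅ := by
      ext w
      simp only [hself hdn', Set.mem_ofPred_eq, Set.mem_empty_iff_false, iff_false, not_and, not_le]
      exact fun h => hBz _ h
    rw [h1, measure_empty, setLIntegral_congr_fun (g := fun _ => 0) hB, lintegral_zero]
    intro p hp
    simp only [hdn', pairError_self (show 1 ≤ m + 2 by omega), if_pos (hBz p hp),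
      ENNReal.ofReal_zero]
  · obtain ⟨e, he1, hue, hev⟩ := hlt hlt'
    have hms : MeasurableSet {q : ℝ × ℝ × ℝ | (q.1, q.2.1) ∈ B ∧ boundary (m + 2) d q.1 ≤ q.2.2} :=
      (hB.preimage (by fun_prop : Measurable fun q : ℝ × ℝ × ℝ => (q.1, q.2.1))).inter
        (measurableSet_le ((continuous_boundary (m + 2) d).measurable.comp measurable_fst)
          (by fun_prop))
    have hlaw := congrArg (fun μ => μ {q : ℝ × ℝ × ℝ | (q.1, q.2.1) ∈ B ∧
      boundary (m + 2) d q.1 ≤ q.2.2}) (map_awgn_components hm hσ (norm_axis hs0) he1 hue)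
    rw [Measure.map_apply (by fun_prop) hms, Measure.map_apply (by fun_prop) hms] at hlaw
    simp only [hev]
    refine hlaw.trans ((prod_prod_angleLaw_cap hm σ (continuous_boundary (m + 2) d).measurable
      hB).trans ?_)
    refine setLIntegral_congr_fun_ae hB ?_
    filter_upwards [ae_pos_polarLaw m σ] with p hp hpB
    rw [pairError_of_lt hd1 hlt' (hBz p hpB) hp]

/-! ### The bounds as integrals against the law of the radial and tangential noise -/

/-- The conditional union bound at `(z, r)`, common to all transmitted codewords. -/
def condUnion {n : ℕ} (C : Submodule (ZMod 2) (Fin n → ZMod 2)) (p : ℝ × ℝ) : ℝ :=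
  ∑ x ∈ nonzeroWords C, pairError n (hammingNorm x) p.1 p.2

lemma hammingNorm_pos_of_mem {n : ℕ} {C : Submodule (ZMod 2) (Fin n → ZMod 2)}
    {x : Fin n → ZMod 2} (hx : x ∈ nonzeroWords C) : 1 ≤ hammingNorm x :=
  hammingNorm_pos_iff.2 (Finset.mem_filter.1 hx).2.2

@[fun_prop]
lemma measurable_condUnion {n : ℕ} (C : Submodule (ZMod 2) (Fin n → ZMod 2)) :
    Measurable (condUnion C) := by
  unfold condUnion
  exact Finset.measurable_sum _ fun x hx =>
    measurable_pairError n _ (hammingNorm_pos_of_mem hx) (hammingNorm_le x)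

lemma condUnion_nonneg {m : ℕ} (hm : 1 ≤ m) (C : Submodule (ZMod 2) (Fin (m + 2) → ZMod 2))
    (p : ℝ × ℝ) : 0 ≤ condUnion C p :=
  Finset.sum_nonneg fun x hx =>
    pairError_nonneg hm (hammingNorm_pos_of_mem hx) (hammingNorm_le x) _ _

lemma condUnion_le {m : ℕ} (hm : 1 ≤ m) (C : Submodule (ZMod 2) (Fin (m + 2) → ZMod 2))
    (p : ℝ × ℝ) : condUnion C p ≤ (nonzeroWords C).card := by
  refine (Finset.sum_le_card_nsmul _ _ 1 fun x hx =>
    pairError_le_one hm (hammingNorm_pos_of_mem hx) (hammingNorm_le x) _ _).trans_eq (by simp)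

lemma three_le_card_nonzeroWords {n : ℕ} {C : Submodule (ZMod 2) (Fin n → ZMod 2)}
    (hC : 2 ≤ Module.finrank (ZMod 2) C) : 3 ≤ (nonzeroWords C).card := by
  have h1 : Fintype.card C = 2 ^ Module.finrank (ZMod 2) C := by
    have := Module.card_eq_pow_finrank (K := ZMod 2) (V := C)
    simpa [ZMod.card] using this
  have h2 : Fintype.card C = (Finset.univ.filter (fun c => c ∈ C)).card := Fintype.card_subtype _
  have h3 : nonzeroWords C = (Finset.univ.filter (fun c => c ∈ C)).erase 0 := by
    ext x; simp [nonzeroWords, and_comm]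
  rw [h3, Finset.card_erase_of_mem (by simp), ← h2, h1]
  have : 2 ^ 2 ≤ 2 ^ Module.finrank (ZMod 2) C := Nat.pow_le_pow_right (by norm_num) hC
  omega

/-- Beyond the origin every codeword contributes at least `1 / 2`. -/
lemma one_lt_condUnion {m : ℕ} (hm : 1 ≤ m) {C : Submodule (ZMod 2) (Fin (m + 2) → ZMod 2)}
    (hC : 2 ≤ Module.finrank (ZMod 2) C) {p : ℝ × ℝ} (hp : Real.sqrt (m + 2 : ℕ) ≤ p.1) :
    1 < condUnion C p := by
  have h := Finset.card_nsmul_le_sum (nonzeroWords C)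
    (fun x => pairError (m + 2) (hammingNorm x) p.1 p.2) (1 / 2)
    fun x hx => half_le_pairError hm (hammingNorm_pos_of_mem hx) (hammingNorm_le x) hp _
  have h3 : (3 : ℝ) ≤ (nonzeroWords C).card := by exact_mod_cast three_le_card_nonzeroWords hC
  rw [nsmul_eq_mul] at h
  unfold condUnion
  linarith

/-- A lower bound for all decision boundaries: inside this radius no pairwise error occurs. -/
lemma div_le_boundary {n d : ℕ} (hd : 1 ≤ d) (hdn : d < n) {z : ℝ} (hz : z < Real.sqrt n) :
    (Real.sqrt n - z) / Real.sqrt n ≤ boundary n d z := by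
  have h1 : (1 : ℝ) ≤ d := by exact_mod_cast hd
  have h2 : (1 : ℝ) ≤ Real.sqrt d := Real.one_le_sqrt.2 h1
  have h3 : Real.sqrt ((n : ℝ) - d) ≤ Real.sqrt n := Real.sqrt_le_sqrt (by linarith)
  have h4 := sqrt_sub_pos hdn
  refine div_le_div₀ (by nlinarith) ?_ h4 h3
  nlinarith

lemma condUnion_eq_zero {m : ℕ} {C : Submodule (ZMod 2) (Fin (m + 2) → ZMod 2)}
    {z r : ℝ} (hz : z < Real.sqrt (m + 2 : ℕ)) (hr : 0 < r)
    (hrz : r ≤ (Real.sqrt (m + 2 : ℕ) - z) / Real.sqrt (m + 2 : ℕ)) : condUnion C (z, r) = 0 := by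
  refine Finset.sum_eq_zero fun x hx => ?_
  have hd := hammingNorm_pos_of_mem hx
  rcases (hammingNorm_le x).eq_or_lt with h | h
  · rw [h, pairError_self (Nat.le_add_left 1 (m + 1)), if_pos hz]
  · rw [pairError_of_lt hd h hz hr, capRatio_of_one_le]
    rw [one_le_div hr]
    exact hrz.trans (div_le_boundary hd h hz)

lemma setIntegral_chiLaw {m : ℕ} (hm : 1 ≤ m) {σ : ℝ} (hσ : 0 < σ) {s : Set ℝ}
    (hs : MeasurableSet s) (f : ℝ → ℝ) :
    ∫ r in s, f r ∂(chiLaw m σ) = ∫ r in s ∩ Set.Ioi 0, f r * gs (m + 1) σ r := by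
  rw [chiLaw, setIntegral_withDensity_eq_setIntegral_toReal_smul (by fun_prop)
    (by filter_upwards with x using ENNReal.ofReal_lt_top) _ hs, Measure.restrict_restrict hs]
  refine setIntegral_congr_fun (hs.inter measurableSet_Ioi) fun r hr => ?_
  simp only [smul_eq_mul]
  rw [ENNReal.toReal_ofReal (gs_pos hm hσ hr.2).le, mul_comm]

lemma integral_chiLaw {m : ℕ} (hm : 1 ≤ m) {σ : ℝ} (hσ : 0 < σ) (f : ℝ → ℝ) :
    ∫ r, f r ∂(chiLaw m σ) = ∫ r in Set.Ioi 0, f r * gs (m + 1) σ r := by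
  rw [← setIntegral_univ, setIntegral_chiLaw hm hσ MeasurableSet.univ, Set.univ_inter]

lemma setIntegral_noiseLaw {σ : ℝ} (hσ : 0 < σ) {s : Set ℝ} (hs : MeasurableSet s) (f : ℝ → ℝ) :
    ∫ z in s, f z ∂(noiseLaw σ) = ∫ z in s, f z * g σ z := by
  rw [noiseLaw_eq hσ, setIntegral_withDensity_eq_setIntegral_toReal_smul (by fun_prop)
    (by filter_upwards with x using ENNReal.ofReal_lt_top) _ hs]
  refine setIntegral_congr_fun hs fun z _ => ?_
  simp only [smul_eq_mul]
  rw [ENNReal.toReal_ofReal (g_pos hσ z).le, mul_comm]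

lemma noiseLaw_real {σ : ℝ} (hσ : 0 < σ) {s : Set ℝ} (hs : MeasurableSet s) :
    (noiseLaw σ).real s = ∫ z in s, g σ z := by
  have := setIntegral_noiseLaw hσ hs (fun _ => 1)
  simpa using this

lemma zero_mem_signals {n : ℕ} (C : Submodule (ZMod 2) (Fin n → ZMod 2)) :
    bpsk 0 ∈ signals C :=
  Finset.mem_image_of_mem _ (by simp)

lemma card_signals_pos {n : ℕ} (C : Submodule (ZMod 2) (Fin n → ZMod 2)) :
    0 < ((signals C).card : ℝ) := by
  exact_mod_cast Finset.card_pos.2 ⟨_, zero_mem_signals C⟩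

/-- An average over the codewords of a quantity that does not depend on the codeword. -/
lemma sum_signals_const {n : ℕ} (C : Submodule (ZMod 2) (Fin n → ZMod 2)) {f : Sig n → ℝ} {a : ℝ}
    (hf : ∀ c ∈ C, f (bpsk c) = a) : ∑ s ∈ signals C, (1 / ((signals C).card : ℝ)) * f s = a := by
  have h : ∀ s ∈ signals C,
      (1 / ((signals C).card : ℝ)) * f s = 1 / ((signals C).card : ℝ) * a := by
    intro s hs
    obtain ⟨c, hc, rfl⟩ := Finset.mem_image.1 hs
    rw [hf c (Finset.mem_filter.1 hc).2]
  rw [Finset.sum_congr rfl h, Finset.sum_const, nsmul_eq_mul, ← mul_assoc,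
    mul_one_div_cancel (card_signals_pos C).ne', one_mul]

lemma fuCond_signals {m : ℕ} {C : Submodule (ZMod 2) (Fin (m + 2) → ZMod 2)} {σ : ℝ} (hσ : 0 < σ)
    {c : Fin (m + 2) → ZMod 2} (hc : c ∈ C) (z : ℝ) :
    fuCond (signals C) σ z (bpsk c) = ∫ r, min (condUnion C (z, r)) 1 ∂(chiLaw (m + 1) σ) := by
  rw [integral_chiLaw (Nat.le_add_left 1 m) hσ, fuCond]
  simp only [fs_signals C hc]
  rfl

lemma fu_signals {m : ℕ} (C : Submodule (ZMod 2) (Fin (m + 2) → ZMod 2)) {σ : ℝ} (hσ : 0 < σ)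
    (z : ℝ) :
    fu (signals C) σ z = ∫ r, min (condUnion C (z, r)) 1 ∂(chiLaw (m + 1) σ) :=
  sum_signals_const C fun _ hc => fuCond_signals hσ hc z

lemma integrable_min_condUnion {m : ℕ} (hm : 1 ≤ m)
    (C : Submodule (ZMod 2) (Fin (m + 2) → ZMod 2)) {α : Type*} [MeasurableSpace α]
    {μ : Measure α} [IsFiniteMeasure μ] {φ : α → ℝ × ℝ} (hφ : Measurable φ) :
    Integrable (fun a => min (condUnion C (φ a)) 1) μ := by
  refine Integrable.of_bound (C := 1) (Measurable.aestronglyMeasurable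
    (((measurable_condUnion C).comp hφ).min measurable_const)) ?_
  filter_upwards with a
  rw [Real.norm_eq_abs, abs_of_nonneg (le_min (condUnion_nonneg hm C _) zero_le_one)]
  exact min_le_right _ _

lemma integrable_condUnion {m : ℕ} (hm : 1 ≤ m)
    (C : Submodule (ZMod 2) (Fin (m + 2) → ZMod 2)) {α : Type*} [MeasurableSpace α]
    {μ : Measure α} [IsFiniteMeasure μ] {φ : α → ℝ × ℝ} (hφ : Measurable φ) :
    Integrable (fun a => condUnion C (φ a)) μ := by
  refine Integrable.of_bound (C := (nonzeroWords C).card)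
    ((measurable_condUnion C).comp hφ).aestronglyMeasurable ?_
  filter_upwards with a
  rw [Real.norm_eq_abs, abs_of_nonneg (condUnion_nonneg hm C _)]
  exact condUnion_le hm C _

lemma fu_le_one {m : ℕ} (hm : 1 ≤ m) (C : Submodule (ZMod 2) (Fin (m + 2) → ZMod 2)) {σ : ℝ}
    (hσ : 0 < σ) (z : ℝ) : fu (signals C) σ z ≤ 1 := by
  have := isProbabilityMeasure_chiLaw (Nat.le_add_left 1 m) hσ
  rw [fu_signals C hσ]
  have h := integral_mono (μ := chiLaw (m + 1) σ)
    (integrable_min_condUnion hm C (φ := fun r => (z, r)) (by fun_prop))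
    (integrable_const 1) (fun r => min_le_right _ _)
  simpa using h

lemma fu_lt_one {m : ℕ} (hm : 1 ≤ m) (C : Submodule (ZMod 2) (Fin (m + 2) → ZMod 2)) {σ : ℝ}
    (hσ : 0 < σ) {z : ℝ} (hz : z < Real.sqrt (m + 2 : ℕ)) : fu (signals C) σ z < 1 := by
  have := isProbabilityMeasure_chiLaw (Nat.le_add_left 1 m) hσ
  have hint := integrable_min_condUnion hm C (μ := chiLaw (m + 1) σ) (φ := fun r => (z, r))
    (by fun_prop)
  rw [fu_signals C hσ]
  have h : 0 < ∫ r, (1 - min (condUnion C (z, r)) 1) ∂(chiLaw (m + 1) σ) := by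
    rw [integral_pos_iff_support_of_nonneg
      (fun r => sub_nonneg.2 (min_le_right _ _)) ((integrable_const 1).sub hint)]
    -- On `(0, b)` the union bound vanishes.
    set b := (Real.sqrt (m + 2 : ℕ) - z) / Real.sqrt (m + 2 : ℕ) with hb
    have hb0 : 0 < b := div_pos (sub_pos.2 hz) (by positivity)
    have hpos : 0 < chiLaw (m + 1) σ (Set.Ioo 0 b) := by
      rw [pos_iff_ne_zero, chiLaw, withDensity_apply _ measurableSet_Ioo,
        Measure.restrict_restrict measurableSet_Ioo,
        Set.inter_eq_left.2 (Set.Ioo_subset_Ioi_self)]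
      intro h0
      rw [lintegral_eq_zero_iff (by fun_prop), Filter.EventuallyEq, ae_restrict_iff'
        measurableSet_Ioo] at h0
      have h2 : volume (Set.Ioo 0 b) = 0 := by
        refine measure_mono_null (fun r hr => ?_) (ae_iff.1 h0)
        simpa [hr.1, hr.2] using gs_pos (Nat.le_add_left 1 m) hσ hr.1
      simp at h2
      linarith
    refine hpos.trans_le (measure_mono fun r hr => ?_)
    simp [condUnion_eq_zero hz hr.1 hr.2.le]
  rw [integral_sub (integrable_const 1) hint] at h
  simp at h
  exact h

lemma fu_eq_one {m : ℕ} (hm : 1 ≤ m) {C : Submodule (ZMod 2) (Fin (m + 2) → ZMod 2)}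
    (hC : 2 ≤ Module.finrank (ZMod 2) C) {σ : ℝ}
    (hσ : 0 < σ) {z : ℝ} (hz : Real.sqrt (m + 2 : ℕ) ≤ z) : fu (signals C) σ z = 1 := by
  have := isProbabilityMeasure_chiLaw (Nat.le_add_left 1 m) hσ
  rw [fu_signals C hσ]
  have : ∀ r, min (condUnion C (z, r)) 1 = 1 := fun r =>
    min_eq_right (one_lt_condUnion hm hC (p := (z, r)) hz).le
  simp [this]

lemma integrable_fu {m : ℕ} (hm : 1 ≤ m) (C : Submodule (ZMod 2) (Fin (m + 2) → ZMod 2)) {σ : ℝ}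
    (hσ : 0 < σ) : Integrable (fu (signals C) σ) (noiseLaw σ) := by
  have := isProbabilityMeasure_chiLaw (Nat.le_add_left 1 m) hσ
  have := isProbabilityMeasure_polarLaw m hσ
  have h := (integrable_min_condUnion hm C (μ := polarLaw m σ) (φ := id)
    measurable_id).integral_prod_left
  refine h.congr ?_
  filter_upwards with z
  rw [fu_signals C hσ]; rfl

lemma integral_fu {m : ℕ} (hm : 1 ≤ m) (C : Submodule (ZMod 2) (Fin (m + 2) → ZMod 2)) {σ : ℝ}
    (hσ : 0 < σ) : ∫ z, fu (signals C) σ z ∂(noiseLaw σ) =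
      ∫ p, min (condUnion C p) 1 ∂(polarLaw m σ) := by
  have := isProbabilityMeasure_chiLaw (Nat.le_add_left 1 m) hσ
  have := isProbabilityMeasure_polarLaw m hσ
  have h := integral_prod _ (integrable_min_condUnion hm C (μ := polarLaw m σ) (φ := id)
    measurable_id)
  simp only [fu_signals C hσ]
  exact h.symm

/-- The excess of the parameterized bound over the integral of `fu`. -/
lemma tsbValue_eq_add {m : ℕ} (hm : 1 ≤ m) (C : Submodule (ZMod 2) (Fin (m + 2) → ZMod 2))
    {σ : ℝ} (hσ : 0 < σ) (t : ℝ) : tsbValue (signals C) σ t =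
      (∫ p, min (condUnion C p) 1 ∂(polarLaw m σ)) +
        ∫ z in Set.Ioi t, (1 - fu (signals C) σ z) ∂(noiseLaw σ) := by
  have hint := integrable_fu hm C hσ
  rw [tsbValue, ← setIntegral_noiseLaw hσ measurableSet_Iic, ← noiseLaw_real hσ measurableSet_Ioi,
    integral_sub (integrable_const 1) hint.integrableOn, ← integral_fu hm C hσ,
    ← integral_add_compl (measurableSet_Iic (a := t)) hint, Set.compl_Iic]
  simp only [integral_const, MeasurableSet.univ, measureReal_restrict_apply, Set.univ_inter,
    smul_eq_mul, mul_one]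
  ring

/-- The bound with the parameter `√n` truncates the union bound pointwise, which is optimal. -/
lemma tsbValue_sqrt {m : ℕ} (hm : 1 ≤ m) {C : Submodule (ZMod 2) (Fin (m + 2) → ZMod 2)}
    (hC : 2 ≤ Module.finrank (ZMod 2) C) {σ : ℝ} (hσ : 0 < σ) :
    tsbValue (signals C) σ (Real.sqrt (m + 2 : ℕ)) =
      ∫ p, min (condUnion C p) 1 ∂(polarLaw m σ) := by
  rw [tsbValue_eq_add hm C hσ, setIntegral_congr_fun (g := fun _ => 0) measurableSet_Ioi]
  · simp
  · intro z hz
    simp [fu_eq_one hm hC hσ (le_of_lt hz)]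

lemma tsbValue_sqrt_le {m : ℕ} (hm : 1 ≤ m) {C : Submodule (ZMod 2) (Fin (m + 2) → ZMod 2)}
    (hC : 2 ≤ Module.finrank (ZMod 2) C) {σ : ℝ} (hσ : 0 < σ) (t : ℝ) :
    tsbValue (signals C) σ (Real.sqrt (m + 2 : ℕ)) ≤ tsbValue (signals C) σ t := by
  rw [tsbValue_sqrt hm hC hσ, tsbValue_eq_add hm C hσ t]
  exact le_add_of_nonneg_right (integral_nonneg fun z => sub_nonneg.2 (fu_le_one hm C hσ z))

lemma tsbValue_sqrt_lt {m : ℕ} (hm : 1 ≤ m) {C : Submodule (ZMod 2) (Fin (m + 2) → ZMod 2)}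
    (hC : 2 ≤ Module.finrank (ZMod 2) C) {σ : ℝ} (hσ : 0 < σ) {t : ℝ}
    (ht : t < Real.sqrt (m + 2 : ℕ)) :
    tsbValue (signals C) σ (Real.sqrt (m + 2 : ℕ)) < tsbValue (signals C) σ t := by
  rw [tsbValue_sqrt hm hC hσ, tsbValue_eq_add hm C hσ t]
  refine lt_add_of_pos_right _ ?_
  rw [setIntegral_pos_iff_support_of_nonneg_ae
    (f := fun z => 1 - fu (signals C) σ z)
    (by filter_upwards with z using sub_nonneg.2 (fu_le_one hm C hσ z))
    (((integrable_const 1).sub (integrable_fu hm C hσ)).integrableOn)]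
  have hsub : Set.Ioo t (Real.sqrt (m + 2 : ℕ)) ⊆
      (Function.support fun z => 1 - fu (signals C) σ z) ∩ Set.Ioi t := by
    intro z hz
    exact ⟨(sub_pos.2 (fu_lt_one hm C hσ hz.2)).ne', hz.1⟩
  refine lt_of_lt_of_le ?_ (measure_mono hsub)
  rw [pos_iff_ne_zero]
  intro h0
  have h1 := noiseLaw_real hσ (measurableSet_Ioo (a := t) (b := Real.sqrt (m + 2 : ℕ)))
  rw [measureReal_def, h0, ENNReal.toReal_zero, ← integral_Ioc_eq_integral_Ioo,
    ← intervalIntegral.integral_of_le ht.le] at h1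
  exact (intervalIntegral.intervalIntegral_pos_of_pos
    ((continuous_g σ).intervalIntegrable _ _) (g_pos hσ) ht).ne h1

lemma generalTSB_eq {m : ℕ} (hm : 1 ≤ m) (C : Submodule (ZMod 2) (Fin (m + 2) → ZMod 2))
    {σ : ℝ} (hσ : 0 < σ) :
    generalTSB (signals C) σ = ∫ p, min (condUnion C p) 1 ∂(polarLaw m σ) := by
  rw [← integral_fu hm C hσ, ← setIntegral_univ, setIntegral_noiseLaw hσ MeasurableSet.univ,
    setIntegral_univ, generalTSB]
  refine integral_congr_ae (Filter.Eventually.of_forall fun z => ?_)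
  simp only
  congr 1
  have h : ∀ r, ∑ s ∈ signals C, (1 / ((signals C).card : ℝ)) * fs (signals C) z r s =
      condUnion C (z, r) := fun r => sum_signals_const C fun c hc => fs_signals C hc z r
  simp only [h]
  rw [← min_eq_left (fu_le_one hm C hσ z), fu_signals C hσ,
    integral_chiLaw (Nat.le_add_left 1 m) hσ]

/-! ### Gallager regions and the decoding error probability -/

lemma bpsk_ne_zero {m : ℕ} (c : Fin (m + 2) → ZMod 2) : bpsk c ≠ 0 := by
  rw [← norm_ne_zero_iff, norm_bpsk]; positivity

/-- Gallager's bound for a region described by the radial and the tangential component. -/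
lemma regionBound_region {m : ℕ} (hm : 1 ≤ m) (C : Submodule (ZMod 2) (Fin (m + 2) → ZMod 2))
    {σ : ℝ} (hσ : 0 < σ) {A : Set (ℝ × ℝ)} (hA : MeasurableSet A) :
    regionBound (signals C) σ (bpsk 0) (region (bpsk 0) A) =
      (∫ p in A, condUnion C p ∂(polarLaw m σ)) + (polarLaw m σ).real Aᶜ := by
  have h1 : {w : Sig (m + 2) | bpsk 0 + w ∈ region (bpsk 0) A} =
      (fun w => (radial (bpsk 0) w, tangential (bpsk 0) w)) ⁻¹' A := by
    ext w; simp [region]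
  have h2 : {w : Sig (m + 2) | bpsk 0 + w ∉ region (bpsk 0) A} =
      (fun w => (radial (bpsk 0) w, tangential (bpsk 0) w)) ⁻¹' Aᶜ := by
    ext w; simp [region]
  have hms : Measurable fun w : Sig (m + 2) => (radial (bpsk 0) w, tangential (bpsk 0) w) := by
    fun_prop
  rw [regionBound, h1, h2, ← map_radial_tangential hm hσ (bpsk_ne_zero 0),
    map_measureReal_apply hms hA.compl,
    setIntegral_map hA (measurable_condUnion C).aestronglyMeasurable hms.aemeasurable]
  simp only [fs_signals C C.zero_mem]
  rfl

lemma sub_nonneg_min (x : ℝ) : 0 ≤ x - min x 1 ∧ 0 ≤ 1 - min x 1 :=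
  ⟨sub_nonneg.2 (min_le_left _ _), sub_nonneg.2 (min_le_right _ _)⟩

/-- The excess of the bound of a region over the tangential-sphere bound: on `A` the union bound
may exceed `1`, and outside `A` the trivial bound `1` may exceed the union bound. -/
lemma regionBound_region_eq_add {m : ℕ} (hm : 1 ≤ m)
    {C : Submodule (ZMod 2) (Fin (m + 2) → ZMod 2)} (hC : 2 ≤ Module.finrank (ZMod 2) C)
    {σ : ℝ} (hσ : 0 < σ) {A : Set (ℝ × ℝ)} (hA : MeasurableSet A) :
    regionBound (signals C) σ (bpsk 0) (region (bpsk 0) A) =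
      tsbValue (signals C) σ (Real.sqrt (m + 2 : ℕ)) +
        ((∫ p in A, (condUnion C p - min (condUnion C p) 1) ∂(polarLaw m σ)) +
          ∫ p in Aᶜ, (1 - min (condUnion C p) 1) ∂(polarLaw m σ)) := by
  have := isProbabilityMeasure_polarLaw m hσ
  have hint := integrable_min_condUnion hm C (μ := polarLaw m σ) (φ := id) measurable_id
  have hint' := integrable_condUnion hm C (μ := polarLaw m σ) (φ := id) measurable_id
  simp only [id] at hint hint'
  rw [regionBound_region hm C hσ hA, tsbValue_sqrt hm hC hσ,
    integral_sub hint'.integrableOn hint.integrableOn,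
    integral_sub (integrable_const 1) hint.integrableOn, ← integral_add_compl hA hint]
  simp only [integral_const, MeasurableSet.univ, measureReal_restrict_apply, Set.univ_inter,
    smul_eq_mul, mul_one]
  ring

lemma tsbValue_le_regionBound {m : ℕ} (hm : 1 ≤ m)
    {C : Submodule (ZMod 2) (Fin (m + 2) → ZMod 2)} (hC : 2 ≤ Module.finrank (ZMod 2) C)
    {σ : ℝ} (hσ : 0 < σ) {A : Set (ℝ × ℝ)} (hA : MeasurableSet A) :
    tsbValue (signals C) σ (Real.sqrt (m + 2 : ℕ)) ≤
      regionBound (signals C) σ (bpsk 0) (region (bpsk 0) A) := by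
  rw [regionBound_region_eq_add hm hC hσ hA]
  exact le_add_of_nonneg_right (add_nonneg (integral_nonneg fun p => (sub_nonneg_min _).1)
    (integral_nonneg fun p => (sub_nonneg_min _).2))

/-- A region attains the tangential-sphere bound iff it lies between `{condUnion C < 1}` and
`{condUnion C ≤ 1}` up to null sets. -/
lemma regionBound_eq_tsbValue_iff {m : ℕ} (hm : 1 ≤ m)
    {C : Submodule (ZMod 2) (Fin (m + 2) → ZMod 2)} (hC : 2 ≤ Module.finrank (ZMod 2) C)
    {σ : ℝ} (hσ : 0 < σ) {A : Set (ℝ × ℝ)} (hA : MeasurableSet A) :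
    regionBound (signals C) σ (bpsk 0) (region (bpsk 0) A) =
      tsbValue (signals C) σ (Real.sqrt (m + 2 : ℕ)) ↔
    ∀ᵐ p ∂(polarLaw m σ), (p ∈ A → condUnion C p ≤ 1) ∧ (p ∉ A → 1 ≤ condUnion C p) := by
  have := isProbabilityMeasure_polarLaw m hσ
  have hint := integrable_min_condUnion hm C (μ := polarLaw m σ) (φ := id) measurable_id
  have hint' := integrable_condUnion hm C (μ := polarLaw m σ) (φ := id) measurable_id
  simp only [id] at hint hint'
  have h1 : 0 ≤ ∫ p in A, (condUnion C p - min (condUnion C p) 1) ∂(polarLaw m σ) :=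
    integral_nonneg fun p => (sub_nonneg_min _).1
  have h2 : 0 ≤ ∫ p in Aᶜ, (1 - min (condUnion C p) 1) ∂(polarLaw m σ) :=
    integral_nonneg fun p => (sub_nonneg_min _).2
  rw [regionBound_region_eq_add hm hC hσ hA, add_eq_left, add_eq_zero_iff_of_nonneg h1 h2,
    setIntegral_eq_zero_iff_of_nonneg_ae
      (Filter.Eventually.of_forall fun p => (sub_nonneg_min _).1) (hint'.sub hint).integrableOn,
    setIntegral_eq_zero_iff_of_nonneg_ae
      (Filter.Eventually.of_forall fun p => (sub_nonneg_min _).2)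
      ((integrable_const 1).sub hint).integrableOn,
    Filter.EventuallyEq, Filter.EventuallyEq, ae_restrict_iff' hA, ae_restrict_iff' hA.compl,
    ← Filter.eventually_and]
  refine Filter.eventually_congr (Filter.Eventually.of_forall fun p => ?_)
  simp only [Pi.zero_apply, sub_eq_zero, Set.mem_compl_iff, left_eq_inf, right_eq_inf]

/-- The union bound inside the region `{Z < √n, condUnion C < 1}` and the trivial bound outside. -/
lemma awgn_error_le {m : ℕ} (hm : 1 ≤ m) {C : Submodule (ZMod 2) (Fin (m + 2) → ZMod 2)}
    (hC : 2 ≤ Module.finrank (ZMod 2) C) {σ : ℝ} (hσ : 0 < σ) {D : Sig (m + 2) → Sig (m + 2)}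
    (hD : IsMLDecoder (signals C) D) {c : Fin (m + 2) → ZMod 2} (hc : c ∈ C) :
    (awgn (m + 2) σ).real {w | D (bpsk c + w) ≠ bpsk c} ≤
      ∫ p, min (condUnion C p) 1 ∂(polarLaw m σ) := by
  have := isProbabilityMeasure_polarLaw m hσ
  have hint := integrable_min_condUnion hm C (μ := polarLaw m σ) (φ := id) measurable_id
  simp only [id] at hint
  have h0 : ∀ p, 0 ≤ min (condUnion C p) 1 := fun p =>
    le_min (condUnion_nonneg hm C p) zero_le_one
  set B : Set (ℝ × ℝ) := {p | p.1 < Real.sqrt (m + 2 : ℕ) ∧ condUnion C p < 1} with hBdef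
  have hB : MeasurableSet B := (measurableSet_lt measurable_fst measurable_const).inter
    (measurableSet_lt (measurable_condUnion C) measurable_const)
  have hms : Measurable fun w : Sig (m + 2) => (radial (bpsk c) w, tangential (bpsk c) w) := by
    fun_prop
  set W := Finset.univ.filter (fun x : Fin (m + 2) → ZMod 2 => x ∈ C ∧ x ≠ c) with hW
  have hsub : {w | D (bpsk c + w) ≠ bpsk c} ⊆
      (⋃ x ∈ W, {w | (radial (bpsk c) w, tangential (bpsk c) w) ∈ B ∧
        dist (bpsk c + w) (bpsk x) ≤ dist (bpsk c + w) (bpsk c)}) ∪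
      (fun w => (radial (bpsk c) w, tangential (bpsk c) w)) ⁻¹' Bᶜ := by
    intro w hw
    by_cases hwB : (radial (bpsk c) w, tangential (bpsk c) w) ∈ B
    · left
      obtain ⟨hDm, hDle⟩ := hD (bpsk c + w)
      obtain ⟨x, hx, hxD⟩ := Finset.mem_image.1 hDm
      refine Set.mem_biUnion (x := x) ?_ ⟨hwB, ?_⟩
      · refine Finset.mem_coe.2 (Finset.mem_filter.2 ⟨Finset.mem_univ _,
          (Finset.mem_filter.1 hx).2, ?_⟩)
        rintro rfl
        exact hw hxD.symm
      · rw [hxD]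
        exact hDle _ (Finset.mem_image_of_mem _ (by simp [hc]))
    · right; exact hwB
  have hsum : ∑ x ∈ W, awgn (m + 2) σ {w | (radial (bpsk c) w, tangential (bpsk c) w) ∈ B ∧
        dist (bpsk c + w) (bpsk x) ≤ dist (bpsk c + w) (bpsk c)} =
      ∫⁻ p in B, ENNReal.ofReal (min (condUnion C p) 1) ∂(polarLaw m σ) := by
    have hxd : ∀ x ∈ W, 1 ≤ hammingDist x c := fun x hx =>
      hammingDist_pos.2 (Finset.mem_filter.1 hx).2.2
    have hxn : ∀ x : Fin (m + 2) → ZMod 2, hammingDist x c ≤ m + 2 := fun x => by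
      simpa using hammingDist_le_card_fintype (x := x) (y := c)
    rw [Finset.sum_congr rfl fun x hx => awgn_pairwise_event hm hσ (Finset.mem_filter.1 hx).2.2 hB
      fun p hp => hp.1, ← lintegral_finsetSum' _ fun x hx =>
        (measurable_pairError (m + 2) _ (hxd x hx) (hxn x)).ennreal_ofReal.aemeasurable]
    refine setLIntegral_congr_fun hB fun p hp => ?_
    rw [min_eq_left hp.2.le, ← ENNReal.ofReal_sum_of_nonneg fun x hx =>
      pairError_nonneg hm (hxd x hx) (hxn x) _ _]
    congr 1
    have h := fs_signals C hc p.1 p.2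
    rw [fs_eq_sum, signals_erase, Finset.sum_image bpsk_injective.injOn] at h
    refine Eq.trans (Finset.sum_congr rfl fun x _ => ?_) h
    rw [norm_bpsk, norm_bpsk, dist_bpsk, pairError]
  have hcompl : awgn (m + 2) σ ((fun w => (radial (bpsk c) w, tangential (bpsk c) w)) ⁻¹' Bᶜ) =
      ∫⁻ p in Bᶜ, ENNReal.ofReal (min (condUnion C p) 1) ∂(polarLaw m σ) := by
    rw [← Measure.map_apply hms hB.compl, map_radial_tangential hm hσ (bpsk_ne_zero c),
      setLIntegral_congr_fun (g := fun _ => 1) hB.compl, setLIntegral_one]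
    intro p hp
    simp only
    rw [min_eq_right, ENNReal.ofReal_one]
    by_contra hlt
    rcases le_or_gt (Real.sqrt (m + 2 : ℕ)) p.1 with h | h
    · exact hlt (one_lt_condUnion hm hC h).le
    · exact hp ⟨h, not_le.1 hlt⟩
  have hle : awgn (m + 2) σ {w | D (bpsk c + w) ≠ bpsk c} ≤
      ∫⁻ p, ENNReal.ofReal (min (condUnion C p) 1) ∂(polarLaw m σ) := by
    refine (measure_mono hsub).trans ((measure_union_le _ _).trans ?_)
    rw [← lintegral_add_compl _ hB, ← hsum, hcompl]
    gcongr
    exact measure_biUnion_finset_le _ _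
  rw [integral_eq_lintegral_of_nonneg_ae (Filter.Eventually.of_forall h0)
    hint.aestronglyMeasurable]
  refine ENNReal.toReal_mono ?_ hle
  exact (lt_of_le_of_lt (lintegral_mono fun p => ENNReal.ofReal_le_one.2 (min_le_right _ _))
    (by simp)).ne

lemma errorProb_le {m : ℕ} (hm : 1 ≤ m) {C : Submodule (ZMod 2) (Fin (m + 2) → ZMod 2)}
    (hC : 2 ≤ Module.finrank (ZMod 2) C) {σ : ℝ} (hσ : 0 < σ) {D : Sig (m + 2) → Sig (m + 2)}
    (hD : IsMLDecoder (signals C) D) :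
    errorProb (signals C) D σ ≤ tsbValue (signals C) σ (Real.sqrt (m + 2 : ℕ)) := by
  rw [tsbValue_sqrt hm hC hσ, ← sum_signals_const C (f := fun _ =>
    ∫ p, min (condUnion C p) 1 ∂(polarLaw m σ)) (fun _ _ => rfl), errorProb]
  refine Finset.sum_le_sum fun s hs => mul_le_mul_of_nonneg_left ?_ (by positivity)
  obtain ⟨c, hc, rfl⟩ := Finset.mem_image.1 hs
  exact awgn_error_le hm hC hσ hD (Finset.mem_filter.1 hc).2

/-! ### The optimal radius -/

/-- The codewords other than the all-zero and the all-one word. -/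
def innerWords {n : ℕ} (C : Submodule (ZMod 2) (Fin n → ZMod 2)) : Finset (Fin n → ZMod 2) :=
  Finset.univ.filter (fun c => c ∈ C ∧ c ≠ 0 ∧ c ≠ 1)

lemma ncard_eq_card_innerWords {n : ℕ} (C : Submodule (ZMod 2) (Fin n → ZMod 2)) :
    Set.ncard {c : Fin n → ZMod 2 | c ∈ C ∧ c ≠ 0 ∧ c ≠ 1} = (innerWords C).card := by
  rw [← Set.ncard_coe_finset]; congr 1; ext c; simp [innerWords]

lemma hammingNorm_mem_innerWords {n : ℕ} {C : Submodule (ZMod 2) (Fin n → ZMod 2)}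
    {x : Fin n → ZMod 2} (hx : x ∈ innerWords C) : 1 ≤ hammingNorm x ∧ hammingNorm x < n := by
  obtain ⟨-, -, h0, h1⟩ := Finset.mem_filter.1 hx
  exact ⟨hammingNorm_pos_iff.2 h0, lt_of_le_of_ne (hammingNorm_le x)
    fun h => h1 ((hammingNorm_eq_iff x).1 h)⟩

lemma boundary_zero {n d : ℕ} (hdn : d < n) :
    boundary n d 0 = Real.sqrt ((n : ℝ) * d / ((n : ℝ) - d)) := by
  have h : (d : ℝ) < n := by exact_mod_cast hdn
  rw [boundary, sub_zero, Real.sqrt_div (by positivity), Real.sqrt_mul (by positivity), mul_comm]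

lemma boundary_eq_mul {n d : ℕ} (hn : 1 ≤ n) (z : ℝ) :
    boundary n d z = (Real.sqrt n - z) / Real.sqrt n * boundary n d 0 := by
  have : 0 < Real.sqrt n := Real.sqrt_pos.2 (by exact_mod_cast hn)
  rw [boundary, boundary]
  field_simp
  ring

/-- The range of summation in `sphereSum` consists of the weights whose decision boundary meets the
sphere. -/
lemma le_threshold_iff {n d : ℕ} (hdn : d < n) {r : ℝ} (hr : 0 < r) :
    (d : ℝ) ≤ r ^ 2 * n / (r ^ 2 + n) ↔ boundary n d 0 ≤ r := by
  have h : (0 : ℝ) < (n : ℝ) - d := sub_pos.2 (by exact_mod_cast hdn)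
  rw [boundary_zero hdn, Real.sqrt_le_left hr.le, div_le_iff₀ h, le_div_iff₀ (by positivity)]
  constructor <;> intro h' <;> nlinarith

lemma sum_innerWords {n : ℕ} (C : Submodule (ZMod 2) (Fin n → ZMod 2)) (f : ℕ → ℝ) :
    ∑ x ∈ innerWords C, f (hammingNorm x) =
      ∑ d ∈ Finset.Icc 1 n, (weightCount C d : ℝ) * (if d < n then f d else 0) := by
  rw [← sum_nonzeroWords C (fun d => if d < n then f d else 0), ← Finset.sum_filter]
  refine Finset.sum_congr ?_ fun _ _ => rfl
  ext x
  have h1 := hammingNorm_eq_iff x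
  have h2 := hammingNorm_le x
  simp only [innerWords, nonzeroWords, Finset.mem_filter, Finset.mem_univ, true_and, and_assoc,
    ne_eq, ← h1]
  constructor <;> rintro ⟨a, b, c⟩ <;> exact ⟨a, b, by omega⟩

lemma sphereSum_eq {n : ℕ} (C : Submodule (ZMod 2) (Fin n → ZMod 2)) {r : ℝ} (hr : 0 < r) :
    sphereSum C r = ∑ x ∈ innerWords C, capRatio n (boundary n (hammingNorm x) 0 / r) := by
  rw [sum_innerWords C (fun d => capRatio n (boundary n d 0 / r)), sphereSum, Finset.sum_filter]
  refine Finset.sum_congr rfl fun d hd => ?_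
  have hd' := Finset.mem_Icc.1 hd
  rcases hd'.2.eq_or_lt with rfl | h
  · have hd0 : (0 : ℝ) < d := by exact_mod_cast hd'.1
    rw [if_neg, if_neg (lt_irrefl _), mul_zero]
    rw [not_le, div_lt_iff₀ (by positivity)]
    nlinarith
  · rw [if_pos h, ← boundary_zero h]
    split_ifs with h1
    · rfl
    · rw [le_threshold_iff h hr, not_le] at h1
      rw [capRatio_of_one_le ((one_le_div hr).2 h1.le), mul_zero]

/-- The union bound in the hyperplane at `z` is the one through `s`, scaled about the origin. -/
lemma condUnion_eq_sphereSum {m : ℕ} (C : Submodule (ZMod 2) (Fin (m + 2) → ZMod 2)) {z r : ℝ}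
    (hz : z < Real.sqrt (m + 2 : ℕ)) (hr : 0 < r) :
    condUnion C (z, r) =
      sphereSum C (r / ((Real.sqrt (m + 2 : ℕ) - z) / Real.sqrt (m + 2 : ℕ))) := by
  set k := (Real.sqrt (m + 2 : ℕ) - z) / Real.sqrt (m + 2 : ℕ) with hk
  have hk0 : 0 < k := div_pos (sub_pos.2 hz) (by positivity)
  rw [sphereSum_eq C (div_pos hr hk0), condUnion,
    sum_nonzeroWords C (fun d => pairError (m + 2) d z r),
    sum_innerWords C (fun d => capRatio (m + 2) (boundary (m + 2) d 0 / (r / k)))]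
  refine Finset.sum_congr rfl fun d hd => ?_
  have hd' := Finset.mem_Icc.1 hd
  rcases hd'.2.eq_or_lt with h | h
  · rw [h, pairError_self (by omega), if_pos hz, if_neg (lt_irrefl _)]
  · rw [if_pos h, pairError_of_lt hd'.1 h hz hr, boundary_eq_mul (by omega), ← hk]
    congr 2
    field_simp

lemma fs_zero_eq_sphereSum {m : ℕ} (C : Submodule (ZMod 2) (Fin (m + 2) → ZMod 2)) {r : ℝ}
    (hr : 0 < r) : fs (signals C) 0 r (bpsk 0) = sphereSum C r := by
  have h := condUnion_eq_sphereSum C (z := 0) (r := r) (by positivity) hr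
  rw [sub_zero, div_self (by positivity), div_one] at h
  rw [← h, fs_signals C C.zero_mem]; rfl

lemma sphereSum_nonneg {m : ℕ} (hm : 1 ≤ m) (C : Submodule (ZMod 2) (Fin (m + 2) → ZMod 2))
    {r : ℝ} (hr : 0 < r) : 0 ≤ sphereSum C r := by
  rw [sphereSum_eq C hr]
  exact Finset.sum_nonneg fun x _ => capRatio_nonneg hm _

lemma boundary_zero_pos {m : ℕ} {C : Submodule (ZMod 2) (Fin (m + 2) → ZMod 2)}
    {x : Fin (m + 2) → ZMod 2} (hx : x ∈ innerWords C) :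
    0 < boundary (m + 2) (hammingNorm x) 0 :=
  boundary_pos (hammingNorm_mem_innerWords hx).1 (hammingNorm_mem_innerWords hx).2 (by positivity)

/-- Strictness comes from a codeword with a cap of positive size at radius `r`. -/
lemma sphereSum_lt_sphereSum {m : ℕ} (hm : 1 ≤ m) (C : Submodule (ZMod 2) (Fin (m + 2) → ZMod 2))
    {r r' : ℝ} (hr : 0 < r) (hrr : r < r') (hpos : 0 < sphereSum C r) :
    sphereSum C r < sphereSum C r' := by
  have hr' := hr.trans hrr
  rw [sphereSum_eq C hr] at hpos
  obtain ⟨x, hx, hx0⟩ := Finset.exists_lt_of_sum_lt (s := innerWords C) (f := fun _ => (0 : ℝ))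
    (by simpa using hpos)
  rw [sphereSum_eq C hr, sphereSum_eq C hr']
  have hlt : ∀ y ∈ innerWords C, boundary (m + 2) (hammingNorm y) 0 / r' <
      boundary (m + 2) (hammingNorm y) 0 / r := fun y hy =>
    div_lt_div_of_pos_left (boundary_zero_pos hy) hr hrr
  refine Finset.sum_lt_sum (fun y hy => capRatio_antitone hm (hlt y hy).le) ⟨x, hx, ?_⟩
  have h1 : boundary (m + 2) (hammingNorm x) 0 / r < 1 := by
    by_contra h
    exact hx0.ne' (capRatio_of_one_le (not_lt.1 h))
  have h0 := div_pos (boundary_zero_pos hx) hr'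
  have h0' := div_pos (boundary_zero_pos hx) hr
  exact capRatio_strictAntiOn hm ⟨by linarith, ((hlt x hx).trans h1).le⟩ ⟨by linarith, h1.le⟩
    (hlt x hx)

lemma sphereSum_lt_one {m : ℕ} (hm : 1 ≤ m) {C : Submodule (ZMod 2) (Fin (m + 2) → ZMod 2)}
    (hC : (innerWords C).card < 3) {r : ℝ} (hr : 0 < r) : sphereSum C r < 1 := by
  rw [sphereSum_eq C hr]
  rcases (innerWords C).eq_empty_or_nonempty with h | h
  · simp [h]
  · calc _ < ∑ _x ∈ innerWords C, (1 / 2 : ℝ) := Finset.sum_lt_sum_of_nonempty h fun x hx =>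
          capRatio_lt_half hm (div_pos (boundary_zero_pos hx) hr)
      _ = (innerWords C).card / 2 := by simp [div_eq_mul_inv]
      _ ≤ 1 := by
          have : ((innerWords C).card : ℝ) ≤ 2 := by exact_mod_cast Nat.le_of_lt_succ hC
          linarith

/-- The union bound through `s` increases from `0` to half the number of inner codewords, which
exceeds `1` as soon as there are three of them. -/
lemma exists_sphereSum_eq_one {m : ℕ} (hm : 1 ≤ m)
    {C : Submodule (ZMod 2) (Fin (m + 2) → ZMod 2)} (hC : 3 ≤ (innerWords C).card) :
    ∃ r₁ : ℝ, 0 < r₁ ∧ sphereSum C r₁ = 1 := by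
  have hcont : ContinuousOn (sphereSum C) (Set.Ioi 0) := by
    have : ContinuousOn (fun r => ∑ x ∈ innerWords C,
        capRatio (m + 2) (boundary (m + 2) (hammingNorm x) 0 / r)) (Set.Ioi 0) :=
      continuousOn_finsetSum _ fun x _ => (continuous_capRatio (m + 2)).comp_continuousOn
        (continuousOn_const.div continuousOn_id fun r hr => (ne_of_gt hr))
    exact this.congr fun r hr => sphereSum_eq C hr
  have hlim : Filter.Tendsto (fun r => ∑ x ∈ innerWords C,
      capRatio (m + 2) (boundary (m + 2) (hammingNorm x) 0 / r)) Filter.atTop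
      (nhds (∑ _x ∈ innerWords C, (1 / 2 : ℝ))) := by
    refine tendsto_finsetSum _ fun x _ => ?_
    rw [← capRatio_zero hm]
    exact ((continuous_capRatio (m + 2)).tendsto 0).comp
      (tendsto_const_nhds.div_atTop Filter.tendsto_id)
  have hbig : (1 : ℝ) < ∑ _x ∈ innerWords C, (1 / 2 : ℝ) := by
    have : (3 : ℝ) ≤ (innerWords C).card := by exact_mod_cast hC
    simp; linarith
  obtain ⟨R, hR, hR1⟩ := ((hlim.eventually (lt_mem_nhds hbig)).and
    (Filter.eventually_ge_atTop 1)).exists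
  rw [← sphereSum_eq C (by linarith)] at hR
  -- No decision boundary in the hyperplane through `s` is closer than `1`.
  have hsmall : sphereSum C 1 = 0 := by
    have h := condUnion_eq_sphereSum C (z := 0) (r := 1) (by positivity) one_pos
    rw [sub_zero, div_self (by positivity), div_one] at h
    rw [← h]
    refine condUnion_eq_zero (by positivity) one_pos ?_
    rw [sub_zero, div_self (by positivity)]
  obtain ⟨r₁, hr₁, h⟩ := intermediate_value_Icc hR1 (hcont.mono fun r hr =>
    lt_of_lt_of_le one_pos hr.1) (show (1 : ℝ) ∈ Set.Icc _ _ from ⟨by rw [hsmall]; norm_num, hR.le⟩)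
  exact ⟨r₁, one_pos.trans_le hr₁.1, h⟩

section radius

variable {m : ℕ} {C : Submodule (ZMod 2) (Fin (m + 2) → ZMod 2)} {r₁ : ℝ}

lemma one_lt_sphereSum (hm : 1 ≤ m) (h₁ : 0 < r₁) (h : sphereSum C r₁ = 1) {r : ℝ} (hr : r₁ < r) :
    1 < sphereSum C r := by
  rw [← h]; exact sphereSum_lt_sphereSum hm C h₁ hr (by rw [h]; exact one_pos)

lemma sphereSum_lt_one_of_lt (hm : 1 ≤ m) (h : sphereSum C r₁ = 1) {r : ℝ} (hr0 : 0 < r)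
    (hr : r < r₁) : sphereSum C r < 1 := by
  rcases (sphereSum_nonneg hm C hr0).eq_or_lt with h0 | h0
  · rw [← h0]; exact one_pos
  · rw [← h]; exact sphereSum_lt_sphereSum hm C hr0 hr h0

lemma sphereSum_eq_one_iff (hm : 1 ≤ m) (h₁ : 0 < r₁) (h : sphereSum C r₁ = 1) {r : ℝ}
    (hr : 0 < r) : sphereSum C r = 1 ↔ r = r₁ := by
  constructor
  · intro hr1
    rcases lt_trichotomy r r₁ with hlt | heq | hgt
    · exact absurd hr1 (sphereSum_lt_one_of_lt hm h hr hlt).ne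
    · exact heq
    · exact absurd hr1 (one_lt_sphereSum hm h₁ h hgt).ne'
  · rintro rfl; exact h

lemma sphereSum_le_one_iff (hm : 1 ≤ m) (h₁ : 0 < r₁) (h : sphereSum C r₁ = 1) {r : ℝ}
    (hr : 0 < r) : sphereSum C r ≤ 1 ↔ r ≤ r₁ := by
  constructor
  · intro h'
    by_contra hlt
    exact absurd (one_lt_sphereSum hm h₁ h (not_le.1 hlt)) (not_lt.2 h')
  · intro h'
    rcases h'.eq_or_lt with rfl | hlt
    · exact h.le
    · exact (sphereSum_lt_one_of_lt hm h hr hlt).le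

end radius

lemma sqrt_one_sub {n d : ℕ} (hn : 1 ≤ n) :
    Real.sqrt (1 - (d : ℝ) / n) = Real.sqrt ((n : ℝ) - d) / Real.sqrt n := by
  have h : (0 : ℝ) < n := by exact_mod_cast hn
  rw [← Real.sqrt_div' _ h.le]; congr 1; field_simp

lemma sqrt_div_mul_sqrt {n d : ℕ} (hdn : d < n) {r : ℝ} :
    Real.sqrt d / (r * Real.sqrt (1 - (d : ℝ) / n)) = boundary n d 0 / r := by
  have h1 := sqrt_sub_pos hdn
  rw [sqrt_one_sub (by omega), boundary, sub_zero]
  field_simp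

lemma mem_poltyrevWeights {n d : ℕ} {r : ℝ} (hr : 0 < r) :
    d ∈ poltyrevWeights n r ↔ 1 ≤ d ∧ d < n ∧ boundary n d 0 < r := by
  rw [poltyrevWeights, Finset.mem_filter, Finset.mem_Icc]
  constructor
  · rintro ⟨⟨h1, h2⟩, h3⟩
    rcases h2.eq_or_lt with rfl | h
    · have : (d : ℝ) ≠ 0 := by positivity
      rw [div_self this, sub_self, Real.sqrt_zero, mul_zero] at h3
      exact absurd h3 (not_lt.2 (Real.sqrt_nonneg _))
    · refine ⟨h1, h, ?_⟩
      have hp : 0 < Real.sqrt (1 - (d : ℝ) / n) := by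
        rw [sqrt_one_sub (by omega)]
        exact div_pos (sqrt_sub_pos h) (Real.sqrt_pos.2 (by exact_mod_cast h1.trans h2))
      rw [← div_lt_one (by positivity), sqrt_div_mul_sqrt h, div_lt_one hr] at h3
      exact h3
  · rintro ⟨h1, h, h3⟩
    refine ⟨⟨h1, h.le⟩, ?_⟩
    have hp : 0 < Real.sqrt (1 - (d : ℝ) / n) := by
      rw [sqrt_one_sub (by omega)]
      exact div_pos (sqrt_sub_pos h) (Real.sqrt_pos.2 (by exact_mod_cast h1.trans h.le))
    rwa [← div_lt_one (by positivity), sqrt_div_mul_sqrt h, div_lt_one hr]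

lemma sum_innerWords_eq_sum_poltyrevWeights {n : ℕ} (C : Submodule (ZMod 2) (Fin n → ZMod 2))
    {r : ℝ} (hr : 0 < r) (f : ℕ → ℝ) (hf : ∀ d, 1 ≤ d → d < n → r ≤ boundary n d 0 → f d = 0) :
    ∑ x ∈ innerWords C, f (hammingNorm x) =
      ∑ d ∈ poltyrevWeights n r, (weightCount C d : ℝ) * f d := by
  rw [sum_innerWords]
  symm
  have hsub : poltyrevWeights n r ⊆ Finset.Icc 1 n := Finset.filter_subset _ _
  rw [← Finset.sum_subset hsub]
  · refine Finset.sum_congr rfl fun d hd => ?_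
    rw [if_pos ((mem_poltyrevWeights hr).1 hd).2.1]
  · intro d hd hd'
    rw [mem_poltyrevWeights hr] at hd'
    split_ifs with h
    · rw [hf d (Finset.mem_Icc.1 hd).1 h, mul_zero]
      by_contra hlt
      exact hd' ⟨(Finset.mem_Icc.1 hd).1, h, not_le.1 hlt⟩
    · rw [mul_zero]

lemma poltyrevOptimal_iff {m : ℕ} (hm : 1 ≤ m) (C : Submodule (ZMod 2) (Fin (m + 2) → ZMod 2))
    {r : ℝ} (hr : 0 < r) : PoltyrevOptimal C r ↔ sphereSum C r = 1 := by
  have hk := angleConst_pos hm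
  have h1 : angleConst m * ∑ d ∈ poltyrevWeights (m + 2) r, (weightCount C d : ℝ) *
      ∫ φ in (0 : ℝ)..Real.arccos (Real.sqrt (d : ℝ) /
        (r * Real.sqrt (1 - (d : ℝ) / (m + 2 : ℕ)))), Real.sin φ ^ (m + 2 - 3) =
      sphereSum C r := by
    rw [sphereSum_eq C hr, sum_innerWords_eq_sum_poltyrevWeights C hr
      (fun d => capRatio (m + 2) (boundary (m + 2) d 0 / r))
      (fun d _ _ h => capRatio_of_one_le ((one_le_div hr).2 h)), Finset.mul_sum]
    refine Finset.sum_congr rfl fun d hd => ?_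
    rw [sqrt_div_mul_sqrt ((mem_poltyrevWeights hr).1 hd).2.1, capRatio_add_two,
      show m + 2 - 3 = m - 1 by omega]
    ring
  have h2 : Real.sqrt Real.pi * Real.Gamma ((((m + 2 : ℕ) : ℝ) - 2) / 2) /
      Real.Gamma ((((m + 2 : ℕ) : ℝ) - 1) / 2) = (angleConst m)⁻¹ := by
    rw [angleConst, inv_div]
    push_cast
    congr 2
    · ring_nf
    · ring_nf
  rw [PoltyrevOptimal, h2, ← h1, ← mul_right_inj' hk.ne' , mul_inv_cancel₀ hk.ne']

/-! ### Rescaling about the origin -/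

lemma gs_mul_scale {m : ℕ} (hm : 1 ≤ m) {σ k : ℝ} (hσ : 0 < σ) (hk : 0 < k) (r : ℝ) :
    k * gs (m + 1) σ (k * r) = gs (m + 1) (σ / k) r := by
  have hm' : (0 : ℝ) < m := by exact_mod_cast hm
  have hG := Real.Gamma_pos_of_pos (show (0 : ℝ) < m / 2 by positivity)
  obtain ⟨j, rfl⟩ : ∃ j, m = j + 1 := ⟨m - 1, by omega⟩
  rw [gs_succ, gs_succ]
  have e1 : -(k * r) ^ 2 / (2 * σ ^ 2) = -r ^ 2 / (2 * (σ / k) ^ 2) := by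
    field_simp
  rw [e1, Nat.add_sub_cancel, mul_pow, div_pow σ k (j + 1)]
  field_simp
  ring

/-- `fu` at `z`, rescaled to the hyperplane through `s`. -/
lemma fu_eq_integral_sphereSum {m : ℕ} (C : Submodule (ZMod 2) (Fin (m + 2) → ZMod 2)) {σ z : ℝ}
    (hσ : 0 < σ) (hz : z < Real.sqrt (m + 2 : ℕ)) :
    fu (signals C) σ z = ∫ r in Set.Ioi 0,
      min (sphereSum C r) 1 * gs (m + 2) (sigmaTilde (m + 2) σ z) r := by
  set k := (Real.sqrt (m + 2 : ℕ) - z) / Real.sqrt (m + 2 : ℕ) with hk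
  have hk0 : 0 < k := div_pos (sub_pos.2 hz) (by positivity)
  have hσk : sigmaTilde (m + 2) σ z = σ / k := by
    rw [sigmaTilde, hk, div_div_eq_mul_div, mul_comm]
  rw [fu_signals C hσ, integral_chiLaw (Nat.le_add_left 1 m) hσ, hσk]
  have h := integral_comp_mul_left_Ioi
    (fun r => min (condUnion C (z, r)) 1 * gs (m + 1 + 1) σ r) 0 hk0
  rw [mul_zero, smul_eq_mul, eq_inv_mul_iff_mul_eq₀ hk0.ne', ← integral_const_mul] at h
  rw [← h]
  refine setIntegral_congr_fun measurableSet_Ioi fun r hr => ?_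
  rw [condUnion_eq_sphereSum C hz (mul_pos hk0 hr), ← hk, mul_div_cancel_left₀ r hk0.ne',
    ← gs_mul_scale (Nat.le_add_left 1 m) hσ hk0]
  ring

lemma sigmaTilde_pos {m : ℕ} {σ z : ℝ} (hσ : 0 < σ) (hz : z < Real.sqrt (m + 2 : ℕ)) :
    0 < sigmaTilde (m + 2) σ z :=
  div_pos (mul_pos (by positivity) hσ) (sub_pos.2 hz)

lemma integrableOn_min_sphereSum_mul_gs {m : ℕ} (hm : 1 ≤ m)
    (C : Submodule (ZMod 2) (Fin (m + 2) → ZMod 2)) {σ : ℝ} (hσ : 0 < σ) :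
    IntegrableOn (fun r => min (sphereSum C r) 1 * gs (m + 2) σ r) (Set.Ioi 0) := by
  have hgs : IntegrableOn (gs (m + 2) σ) (Set.Ioi 0) := integrableOn_gs (Nat.le_add_left 1 m) hσ
  have hmeas : AEStronglyMeasurable (fun r => min (sphereSum C r) 1)
      (volume.restrict (Set.Ioi 0)) := by
    have h1 : Measurable fun r : ℝ => min (condUnion C (0, r)) 1 :=
      ((measurable_condUnion C).comp (by fun_prop)).min measurable_const
    refine h1.aestronglyMeasurable.congr ?_
    filter_upwards [ae_restrict_mem measurableSet_Ioi] with r hr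
    rw [condUnion_eq_sphereSum C (by positivity) hr, sub_zero, div_self (by positivity), div_one]
  refine Integrable.bdd_mul (c := 1) hgs hmeas ?_
  filter_upwards [ae_restrict_mem measurableSet_Ioi] with r hr
  rw [Real.norm_eq_abs, abs_of_nonneg (le_min (sphereSum_nonneg hm C hr) zero_le_one)]
  exact min_le_right _ _

lemma fu_eq_fuLinear {m : ℕ} (hm : 1 ≤ m) {C : Submodule (ZMod 2) (Fin (m + 2) → ZMod 2)}
    {r₁ : ℝ} (h₁ : 0 < r₁) (h : sphereSum C r₁ = 1) {σ z : ℝ} (hσ : 0 < σ)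
    (hz : z < Real.sqrt (m + 2 : ℕ)) : fu (signals C) σ z = fuLinear C r₁ σ z := by
  have hint := integrableOn_min_sphereSum_mul_gs hm C (sigmaTilde_pos hσ hz)
  rw [fu_eq_integral_sphereSum C hσ hz, fuLinear, intervalIntegral.integral_of_le h₁.le,
    ← Set.Ioc_union_Ioi_eq_Ioi h₁.le, setIntegral_union Set.Ioc_disjoint_Ioi_same
      measurableSet_Ioi (hint.mono_set Set.Ioc_subset_Ioi_self)
      (hint.mono_set (Set.Ioi_subset_Ioi h₁.le))]
  congr 1
  · refine setIntegral_congr_fun measurableSet_Ioc fun r hr => ?_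
    rw [min_eq_left ((sphereSum_le_one_iff hm h₁ h hr.1).2 hr.2)]
  · refine setIntegral_congr_fun measurableSet_Ioi fun r hr => ?_
    rw [min_eq_right (one_lt_sphereSum hm h₁ h hr).le, one_mul]

lemma integral_fuLinear_add {m : ℕ} (hm : 1 ≤ m) {C : Submodule (ZMod 2) (Fin (m + 2) → ZMod 2)}
    {r₁ : ℝ} (h₁ : 0 < r₁) (h : sphereSum C r₁ = 1) {σ : ℝ} (hσ : 0 < σ) :
    (∫ z in Set.Iic (Real.sqrt (m + 2 : ℕ)), fuLinear C r₁ σ z * g σ z) +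
        (awgn (m + 2) σ).real {w | Real.sqrt (m + 2 : ℕ) ≤ radial (bpsk 0) w} =
      tsbValue (signals C) σ (Real.sqrt (m + 2 : ℕ)) := by
  have := isProbabilityMeasure_chiLaw (Nat.le_add_left 1 m) hσ
  rw [tsbValue]
  congr 1
  · rw [integral_Iic_eq_integral_Iio, integral_Iic_eq_integral_Iio]
    refine setIntegral_congr_fun measurableSet_Iio fun z hz => ?_
    rw [fu_eq_fuLinear hm h₁ h hσ hz]
  · have hms : Measurable fun w : Sig (m + 2) => (radial (bpsk 0) w, tangential (bpsk 0) w) := by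
      fun_prop
    have h2 : {w : Sig (m + 2) | Real.sqrt (m + 2 : ℕ) ≤ radial (bpsk 0) w} =
        (fun w => (radial (bpsk 0) w, tangential (bpsk 0) w)) ⁻¹'
          (Set.Ici (Real.sqrt (m + 2 : ℕ)) ×ˢ Set.univ) := by
      ext w; simp
    rw [h2, ← map_measureReal_apply hms (measurableSet_Ici.prod MeasurableSet.univ),
      map_radial_tangential hm hσ (bpsk_ne_zero 0), polarLaw, measureReal_prod_prod,
      noiseLaw_real hσ measurableSet_Ici, integral_Ici_eq_integral_Ioi]
    simp

/-! ### The half-cone -/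

lemma radial_sub_bpsk {n : ℕ} (hn : 1 ≤ n) (y : Sig n) :
    radial (bpsk 0) (y - bpsk 0) = Real.sqrt n - inner ℝ (bpsk 0) y / Real.sqrt n := by
  have h0 : (0 : ℝ) < n := by exact_mod_cast hn
  have h1 := Real.sqrt_pos.2 h0
  have h2 := Real.sq_sqrt h0.le
  rw [radial, inner_neg_right, inner_smul_right, inner_sub_left, inner_bpsk, norm_bpsk,
    real_inner_comm, hammingDist_self]
  field_simp
  rw [h2]; push_cast; ring

lemma tangential_sub_bpsk_sq {n : ℕ} (hn : 1 ≤ n) (y : Sig n) :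
    tangential (bpsk 0) (y - bpsk 0) ^ 2 = ‖y‖ ^ 2 - (inner ℝ (bpsk 0) y / Real.sqrt n) ^ 2 := by
  have h0 : (0 : ℝ) < n := by exact_mod_cast hn
  have h1 := Real.sqrt_pos.2 h0
  have h2 := Real.sq_sqrt h0.le
  have e : y - bpsk 0 - radial (bpsk 0) (y - bpsk 0) • (-(‖(bpsk 0 : Sig n)‖⁻¹ • bpsk 0)) =
      y - (inner ℝ (bpsk 0) y / n : ℝ) • bpsk 0 := by
    rw [radial_sub_bpsk hn, norm_bpsk, smul_neg, smul_smul, sub_neg_eq_add]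
    have : 1 - (Real.sqrt n - inner ℝ (bpsk 0) y / Real.sqrt n) * (Real.sqrt n)⁻¹ =
        (inner ℝ (bpsk 0) y / n : ℝ) := by
      field_simp
      rw [h2]; ring
    rw [← this, sub_smul 1, one_smul]
    abel
  rw [tangential, e, @norm_sub_sq_real, inner_smul_right, norm_smul, norm_bpsk, real_inner_comm,
    mul_pow, Real.norm_eq_abs, sq_abs, h2, div_pow, div_pow, h2, real_inner_comm]
  field_simp
  ring

/-- The radial and tangential coordinates of the half-cone. -/
def conePairs (n : ℕ) (r : ℝ) : Set (ℝ × ℝ) :=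
  {p : ℝ × ℝ | p.1 < Real.sqrt n ∧ p.2 ≤ r * (Real.sqrt n - p.1) / Real.sqrt n}

lemma measurableSet_conePairs (n : ℕ) (r : ℝ) : MeasurableSet (conePairs n r) :=
  (measurableSet_lt measurable_fst measurable_const).inter
    (measurableSet_le measurable_snd
      (by fun_prop : Measurable fun p : ℝ × ℝ => r * (Real.sqrt n - p.1) / Real.sqrt n))

/-- With `a` the component of `y` along `s` and `T` its tangential norm, both conditions say
`0 < a` and `T ≤ (r / √n) a`. The angle of `y = 0` is `π / 2` by convention, so the apex lies in
neither set. -/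
lemma region_conePairs {n : ℕ} (hn : 1 ≤ n) {r : ℝ} (hr : 0 < r) :
    region (bpsk 0) (conePairs n r) =
      halfCone (bpsk 0 : Sig n) (Real.arctan (r / Real.sqrt n)) := by
  have h0 : (0 : ℝ) < n := by exact_mod_cast hn
  have h1 := Real.sqrt_pos.2 h0
  ext y
  have hT := tangential_sub_bpsk_sq hn y
  have hT0 : 0 ≤ tangential (bpsk 0) (y - bpsk 0) := norm_nonneg _
  have hR := radial_sub_bpsk hn y
  have hangle : InnerProductGeometry.angle (bpsk 0) y =
      Real.arccos (inner ℝ (bpsk 0) y / Real.sqrt n / ‖y‖) := by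
    rw [InnerProductGeometry.angle, norm_bpsk, div_div]
  have habs : |inner ℝ (bpsk 0) y / Real.sqrt n / ‖y‖| ≤ 1 := by
    rw [div_div, ← norm_bpsk (0 : Fin n → ZMod 2)]
    exact abs_real_inner_div_norm_mul_norm_le_one _ _
  change radial (bpsk 0) (y - bpsk 0) < _ ∧ tangential (bpsk 0) (y - bpsk 0) ≤
      r * (Real.sqrt n - radial (bpsk 0) (y - bpsk 0)) / Real.sqrt n ↔
    InnerProductGeometry.angle (bpsk 0) y ≤ _
  rw [hR, hangle]
  generalize inner ℝ (bpsk 0) y / Real.sqrt n = a at *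
  generalize tangential (bpsk 0) (y - bpsk 0) = T at *
  set ρ := r / Real.sqrt n with hρ
  have hρ0 : 0 < ρ := div_pos hr h1
  have hact : Real.arctan ρ = Real.arccos (1 / Real.sqrt (1 + ρ ^ 2)) := by
    rw [← Real.cos_arctan, Real.arccos_cos (Real.arctan_nonneg.2 hρ0.le)]
    linarith [Real.arctan_lt_pi_div_two ρ, Real.pi_pos]
  have hs : 0 < Real.sqrt (1 + ρ ^ 2) := by positivity
  have hs2 : Real.sqrt (1 + ρ ^ 2) ^ 2 = 1 + ρ ^ 2 := Real.sq_sqrt (by positivity)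
  have hs1 : 1 / Real.sqrt (1 + ρ ^ 2) ≤ 1 := by
    rw [div_le_one hs]; exact Real.one_le_sqrt.2 (by nlinarith)
  have hs0 : 0 < 1 / Real.sqrt (1 + ρ ^ 2) := by positivity
  rw [hact, Real.strictAntiOn_arccos.le_iff_ge (abs_le.1 habs) ⟨by linarith, hs1⟩,
    show r * (Real.sqrt n - (Real.sqrt n - a)) / Real.sqrt n = ρ * a by rw [hρ]; ring]
  rcases le_or_gt a 0 with ha | ha
  · constructor
    · rintro ⟨h, -⟩; linarith
    · intro h
      have := div_nonpos_of_nonpos_of_nonneg ha (norm_nonneg y)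
      linarith
  · have hy : 0 < ‖y‖ := by
      by_contra h
      have : ‖y‖ = 0 := le_antisymm (not_lt.1 h) (norm_nonneg y)
      rw [this] at hT
      nlinarith
    have hl : Real.sqrt n - a < Real.sqrt n := by linarith
    rw [div_le_div_iff₀ hs hy, one_mul, ← sq_le_sq₀ hy.le (by positivity), mul_pow, hs2]
    simp only [hl, true_and]
    rw [← sq_le_sq₀ hT0 (by positivity), hT, mul_pow]
    constructor <;> intro h <;> linarith

section cone

variable {m : ℕ} {C : Submodule (ZMod 2) (Fin (m + 2) → ZMod 2)} {r₁ : ℝ}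

lemma mem_conePairs_iff {n : ℕ} {z r : ℝ} (hn : 1 ≤ n) (hz : z < Real.sqrt n) :
    (z, r) ∈ conePairs n r₁ ↔ r / ((Real.sqrt n - z) / Real.sqrt n) ≤ r₁ := by
  have h1 : 0 < Real.sqrt n := Real.sqrt_pos.2 (by exact_mod_cast hn)
  have h2 : 0 < (Real.sqrt n - z) / Real.sqrt n := div_pos (sub_pos.2 hz) h1
  rw [div_le_iff₀ h2, ← mul_div_assoc]
  exact ⟨fun h => h.2, fun h => ⟨hz, h⟩⟩

/-- The half-cone is where the union bound does not exceed `1`. -/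
lemma condUnion_le_one_iff (hm : 1 ≤ m) (hC : 2 ≤ Module.finrank (ZMod 2) C) (h₁ : 0 < r₁)
    (h : sphereSum C r₁ = 1) {p : ℝ × ℝ} (hp : 0 < p.2) :
    condUnion C p ≤ 1 ↔ p ∈ conePairs (m + 2) r₁ := by
  obtain ⟨z, r⟩ := p
  rcases le_or_gt (Real.sqrt (m + 2 : ℕ)) z with hz | hz
  · have := one_lt_condUnion hm hC (p := (z, r)) hz
    constructor
    · intro h; linarith
    · intro h; exact absurd h.1 (not_lt.2 hz)
  · have hk : 0 < (Real.sqrt (m + 2 : ℕ) - z) / Real.sqrt (m + 2 : ℕ) :=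
      div_pos (sub_pos.2 hz) (by positivity)
    rw [mem_conePairs_iff (by omega) hz, condUnion_eq_sphereSum C hz hp,
      sphereSum_le_one_iff hm h₁ h (div_pos hp hk)]

/-- The boundary of the half-cone, where the union bound equals `1`, is a null set. -/
lemma ae_condUnion_ne_one (hm : 1 ≤ m) (hC : 2 ≤ Module.finrank (ZMod 2) C) (h₁ : 0 < r₁)
    (h : sphereSum C r₁ = 1) (σ : ℝ) : ∀ᵐ p ∂(polarLaw m σ), condUnion C p ≠ 1 := by
  have hnull : ∀ᵐ p ∂(polarLaw m σ),
      p.2 ≠ r₁ * ((Real.sqrt (m + 2 : ℕ) - p.1) / Real.sqrt (m + 2 : ℕ)) := by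
    have hms : MeasurableSet {p : ℝ × ℝ | ¬ (p.2 ≠ r₁ * ((Real.sqrt (m + 2 : ℕ) - p.1) /
        Real.sqrt (m + 2 : ℕ)))} := by
      simp only [ne_eq, not_not]
      exact measurableSet_eq_fun (by fun_prop) (by fun_prop)
    rw [ae_iff, polarLaw, Measure.measure_prod_null hms]
    filter_upwards with z
    refine (withDensity_absolutelyContinuous _ _)
      ((Measure.restrict_le_self.absolutelyContinuous) ?_)
    refine measure_mono_null (t := {r₁ * ((Real.sqrt (m + 2 : ℕ) - z) /
      Real.sqrt (m + 2 : ℕ))}) (fun r hr => ?_) (measure_singleton _)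
    simpa using hr
  filter_upwards [hnull, ae_pos_polarLaw m σ] with p hp hp0 heq
  have hlt : p.1 < Real.sqrt (m + 2 : ℕ) := by
    by_contra hge
    exact (one_lt_condUnion hm hC (not_lt.1 hge)).ne' heq
  have hk : 0 < (Real.sqrt (m + 2 : ℕ) - p.1) / Real.sqrt (m + 2 : ℕ) :=
    div_pos (sub_pos.2 hlt) (by positivity)
  rw [show p = (p.1, p.2) from rfl, condUnion_eq_sphereSum C hlt hp0,
    sphereSum_eq_one_iff hm h₁ h (div_pos hp0 hk), div_eq_iff hk.ne'] at heq
  exact hp heq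

lemma regionBound_halfCone (hm : 1 ≤ m) (hC : 2 ≤ Module.finrank (ZMod 2) C) (h₁ : 0 < r₁)
    (h : sphereSum C r₁ = 1) {σ : ℝ} (hσ : 0 < σ) :
    regionBound (signals C) σ (bpsk 0)
        (halfCone (bpsk 0) (Real.arctan (r₁ / Real.sqrt (m + 2 : ℕ)))) =
      tsbValue (signals C) σ (Real.sqrt (m + 2 : ℕ)) := by
  rw [← region_conePairs (by omega) h₁,
    regionBound_eq_tsbValue_iff hm hC hσ (measurableSet_conePairs _ _)]
  filter_upwards [ae_pos_polarLaw m σ] with p hp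
  rw [← condUnion_le_one_iff hm hC h₁ h hp]
  exact ⟨id, fun h' => (not_le.1 h').le⟩

/-- A minimizing region agrees with the half-cone up to a null set. -/
lemma ae_mem_region_iff_mem_halfCone (hm : 1 ≤ m) (hC : 2 ≤ Module.finrank (ZMod 2) C)
    (h₁ : 0 < r₁) (h : sphereSum C r₁ = 1) {σ : ℝ} (hσ : 0 < σ) {A : Set (ℝ × ℝ)}
    (hA : MeasurableSet A)
    (heq : regionBound (signals C) σ (bpsk 0) (region (bpsk 0) A) =
      tsbValue (signals C) σ (Real.sqrt (m + 2 : ℕ))) :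
    ∀ᵐ w ∂(awgn (m + 2) σ), (bpsk 0 + w ∈ region (bpsk 0) A ↔
      bpsk 0 + w ∈ halfCone (bpsk 0) (Real.arctan (r₁ / Real.sqrt (m + 2 : ℕ)))) := by
  have hms : Measurable fun w : Sig (m + 2) => (radial (bpsk 0) w, tangential (bpsk 0) w) := by
    fun_prop
  rw [regionBound_eq_tsbValue_iff hm hC hσ hA] at heq
  have hae : ∀ᵐ p ∂(polarLaw m σ), (p ∈ A ↔ p ∈ conePairs (m + 2) r₁) := by
    filter_upwards [heq, ae_pos_polarLaw m σ, ae_condUnion_ne_one hm hC h₁ h σ] with p hp hp0 hne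
    rw [← condUnion_le_one_iff hm hC h₁ h hp0]
    refine ⟨hp.1, fun hle => ?_⟩
    by_contra hpA
    exact hne (le_antisymm hle (hp.2 hpA))
  rw [← map_radial_tangential hm hσ (bpsk_ne_zero 0)] at hae
  filter_upwards [ae_of_ae_map hms.aemeasurable hae] with w hw
  rw [← region_conePairs (by omega) h₁]
  simpa only [region, Set.mem_ofPred_eq, add_sub_cancel_left] using hw

end cone

/-! ### Poltyrev's form of the bound -/

lemma two_mul_mul_chiSqPDF {m : ℕ} (hm : 1 ≤ m) {σ r : ℝ} (hr : 0 < r) :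
    2 * r * chiSqPDF m σ (r ^ 2) = gs (m + 1) σ r := by
  obtain ⟨j, rfl⟩ : ∃ j, m = j + 1 := ⟨m - 1, by omega⟩
  have e : r * (r ^ 2) ^ ((((j + 1 : ℕ) : ℝ) - 2) / 2) = r ^ j := by
    rw [← Real.rpow_natCast r 2, ← Real.rpow_mul hr.le]
    nth_rw 1 [← Real.rpow_one r]
    rw [← Real.rpow_add hr, ← Real.rpow_natCast r j]
    congr 1; push_cast; ring
  rw [gs_succ, chiSqPDF, Nat.add_sub_cancel, Real.rpow_natCast, ← e]
  ring

/-- The substitution `v = r²` between the squared norm and the norm. -/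
lemma integral_chiSqPDF {m : ℕ} (hm : 1 ≤ m) (σ : ℝ) {x : ℝ} (hx : 0 ≤ x) :
    ∫ v in (0 : ℝ)..x ^ 2, chiSqPDF m σ v = ∫ r in Set.Ioc 0 x, gs (m + 1) σ r := by
  have himage : (fun r : ℝ => r ^ 2) '' Set.Ioc 0 x = Set.Ioc 0 (x ^ 2) := by
    ext v
    constructor
    · rintro ⟨r, hr, rfl⟩
      exact ⟨pow_pos hr.1 2, pow_le_pow_left₀ hr.1.le hr.2 2⟩
    · rintro ⟨h0, h1⟩
      exact ⟨Real.sqrt v, ⟨Real.sqrt_pos.2 h0, Real.sqrt_le_iff.2 ⟨hx, h1⟩⟩, Real.sq_sqrt h0.le⟩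
  rw [intervalIntegral.integral_of_le (by positivity), ← himage,
    integral_image_eq_integral_abs_deriv_smul (f' := fun r => 2 * r) measurableSet_Ioc]
  · refine setIntegral_congr_fun measurableSet_Ioc fun r hr => ?_
    have hr0 := hr.1
    simp only [smul_eq_mul]
    rw [abs_of_pos (by positivity), two_mul_mul_chiSqPDF hm hr.1]
  · intro r _
    simpa using (hasDerivAt_pow 2 r).hasDerivWithinAt
  · intro a ha b hb hab
    exact (sq_eq_sq₀ ha.1.le hb.1.le).1 hab

lemma prod_real_apply {α β : Type*} [MeasurableSpace α] [MeasurableSpace β] (μ : Measure α)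
    (ν : Measure β) [IsProbabilityMeasure ν] {s : Set (α × β)} (hs : MeasurableSet s) :
    (μ.prod ν).real s = ∫ x, ν.real (Prod.mk x ⁻¹' s) ∂μ := by
  rw [measureReal_def, Measure.prod_apply hs]
  exact (integral_toReal (measurable_measure_prodMk_left hs).aemeasurable
    (Filter.Eventually.of_forall fun x => measure_lt_top ν _)).symm

lemma chiLaw_real {m : ℕ} (hm : 1 ≤ m) {σ : ℝ} (hσ : 0 < σ) {s : Set ℝ} (hs : MeasurableSet s) :
    (chiLaw m σ).real s = ∫ r in s ∩ Set.Ioi 0, gs (m + 1) σ r := by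
  have := setIntegral_chiLaw hm hσ hs (fun _ => 1)
  simpa using this

/-- The probability that a noise vector of dimension `m + 1` lies in a spherical cap of the ball
of radius `R`, in Cartesian and in polar coordinates. -/
lemma integral_g_mul_integral_chiSqPDF {m : ℕ} (hm : 1 ≤ m) {σ b R : ℝ} (hσ : 0 < σ) (hb : 0 < b)
    (hbR : b ≤ R) :
    ∫ x in b..R, g σ x * ∫ v in (0 : ℝ)..(R ^ 2 - x ^ 2), chiSqPDF m σ v =
      ∫ r in Set.Ioc 0 R, capRatio (m + 2) (b / r) * gs (m + 2) σ r := by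
  have hP := isProbabilityMeasure_chiLaw hm hσ
  have hP' := isProbabilityMeasure_chiLaw (Nat.le_add_left 1 m) hσ
  have hA := isProbabilityMeasure_angleLaw hm
  have hR : 0 < R := hb.trans_le hbR
  set S : Set (ℝ × ℝ) := {p | b ≤ p.1 ∧ p.1 ^ 2 + p.2 ^ 2 ≤ R ^ 2} with hS
  have hSm : MeasurableSet S := (measurableSet_le measurable_const measurable_fst).inter
    (measurableSet_le (by fun_prop : Measurable fun p : ℝ × ℝ => p.1 ^ 2 + p.2 ^ 2)
      measurable_const)
  have hpol : Measurable (fun p : ℝ × ℝ => (p.1 * Real.cos p.2, p.1 * Real.sin p.2)) := by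
    fun_prop
  have h1 : ((noiseLaw σ).prod (chiLaw m σ)).real S =
      ∫ x in b..R, g σ x * ∫ v in (0 : ℝ)..(R ^ 2 - x ^ 2), chiSqPDF m σ v := by
    rw [prod_real_apply _ _ hSm, intervalIntegral.integral_of_le hbR,
      ← integral_Icc_eq_integral_Ioc, ← setIntegral_eq_integral_of_forall_compl_eq_zero
        (s := Set.Icc b R), setIntegral_noiseLaw hσ measurableSet_Icc]
    · refine setIntegral_congr_fun measurableSet_Icc fun x hx => ?_
      have hx0 : 0 ≤ R ^ 2 - x ^ 2 := sub_nonneg.2 (pow_le_pow_left₀ (hb.le.trans hx.1) hx.2 2)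
      have hset : (Prod.mk x ⁻¹' S) ∩ Set.Ioi 0 = Set.Ioc 0 (Real.sqrt (R ^ 2 - x ^ 2)) := by
        ext v
        simp only [hS, Set.mem_inter_iff, Set.mem_preimage, Set.mem_ofPred_eq, Set.mem_Ioi,
          Set.mem_Ioc]
        constructor
        · rintro ⟨⟨_, h⟩, h0⟩
          exact ⟨h0, Real.le_sqrt_of_sq_le (by linarith)⟩
        · rintro ⟨h0, h⟩
          have := (Real.le_sqrt h0.le hx0).1 h
          exact ⟨⟨hx.1, by linarith⟩, h0⟩
      have h2 := integral_chiSqPDF hm σ (Real.sqrt_nonneg (R ^ 2 - x ^ 2))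
      rw [Real.sq_sqrt hx0] at h2
      rw [chiLaw_real hm hσ (hSm.preimage (by fun_prop)), hset, h2, mul_comm]
    · intro x hx
      have : Prod.mk x ⁻¹' S = ∅ := by
        ext v
        simp only [hS, Set.mem_preimage, Set.mem_ofPred_eq, Set.mem_empty_iff_false, iff_false]
        rintro ⟨h, h'⟩
        refine hx ⟨h, ?_⟩
        exact (sq_le_sq₀ (hb.le.trans h) hR.le).1 (by nlinarith)
      rw [this]; simp
  have h2 : ((noiseLaw σ).prod (chiLaw m σ)).real S =
      ∫ r in Set.Iic R, capRatio (m + 2) (b / r) ∂(chiLaw (m + 1) σ) := by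
    rw [polar_pushforward hm hσ, map_measureReal_apply hpol hSm, prod_real_apply _ _ (hpol hSm),
      ← integral_indicator measurableSet_Iic]
    refine integral_congr_ae ?_
    filter_upwards [ae_pos_chiLaw (m + 1) σ] with r hr
    have hsq : ∀ φ, (r * Real.cos φ) ^ 2 + (r * Real.sin φ) ^ 2 = r ^ 2 := fun φ => by
      rw [mul_pow, mul_pow, Real.cos_sq']; ring
    by_cases hrR : r ≤ R
    · rw [Set.indicator_of_mem (Set.mem_Iic.2 hrR), measureReal_def]
      have : Prod.mk r ⁻¹' ((fun p : ℝ × ℝ => (p.1 * Real.cos p.2, p.1 * Real.sin p.2)) ⁻¹' S) =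
          {φ | b / r ≤ Real.cos φ} := by
        ext φ
        simp only [hS, Set.mem_preimage, Set.mem_ofPred_eq, hsq, div_le_iff₀' hr]
        exact ⟨fun h => h.1, fun h => ⟨h, pow_le_pow_left₀ hr.le hrR 2⟩⟩
      rw [this, angleLaw_cap hm, ENNReal.toReal_ofReal (capRatio_nonneg hm _)]
    · rw [Set.indicator_of_notMem (mt Set.mem_Iic.1 hrR)]
      have : Prod.mk r ⁻¹' ((fun p : ℝ × ℝ => (p.1 * Real.cos p.2, p.1 * Real.sin p.2)) ⁻¹' S) =
          ∅ := by
        ext φ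
        simp only [hS, Set.mem_preimage, Set.mem_ofPred_eq, hsq, Set.mem_empty_iff_false,
          iff_false, not_and]
        intro _ h
        exact hrR ((sq_le_sq₀ hr.le hR.le).1 h)
      rw [this]; simp
  rw [← h1, h2, setIntegral_chiLaw (Nat.le_add_left 1 m) hσ measurableSet_Iic,
    Set.inter_comm, Set.Ioi_inter_Iic]

lemma integral_Ioi_g {σ : ℝ} (hσ : 0 < σ) (a : ℝ) : ∫ z in Set.Ioi a, g σ z = Q (a / σ) := by
  have h := integral_comp_mul_left_Ioi
    (fun z => 1 / Real.sqrt (2 * Real.pi) * Real.exp (-z ^ 2 / 2)) a (inv_pos.2 hσ)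
  rw [inv_inv, smul_eq_mul, ← div_eq_inv_mul] at h
  rw [Q, ← mul_right_inj' hσ.ne', ← h, ← integral_const_mul]
  refine integral_congr_ae (Filter.Eventually.of_forall fun z => ?_)
  simp only [g]
  have : -(σ⁻¹ * z) ^ 2 / 2 = -z ^ 2 / (2 * σ ^ 2) := by field_simp
  rw [this]
  field_simp

lemma condUnion_eq_sum_innerWords {m : ℕ} (C : Submodule (ZMod 2) (Fin (m + 2) → ZMod 2))
    {z r : ℝ} (hz : z < Real.sqrt (m + 2 : ℕ)) (hr : 0 < r) :
    condUnion C (z, r) =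
      ∑ x ∈ innerWords C, capRatio (m + 2) (boundary (m + 2) (hammingNorm x) z / r) := by
  have hk : 0 < (Real.sqrt (m + 2 : ℕ) - z) / Real.sqrt (m + 2 : ℕ) :=
    div_pos (sub_pos.2 hz) (by positivity)
  rw [condUnion_eq_sphereSum C hz hr, sphereSum_eq C (div_pos hr hk)]
  refine Finset.sum_congr rfl fun x _ => ?_
  rw [boundary_eq_mul (by omega) z]
  congr 1
  field_simp

section poltyrev

variable {m : ℕ} {C : Submodule (ZMod 2) (Fin (m + 2) → ZMod 2)} {r₁ : ℝ}

/-- Inside the cone the union bound is used, outside the trivial bound. -/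
lemma fu_eq_add (hm : 1 ≤ m) (hC : 2 ≤ Module.finrank (ZMod 2) C) (h₁ : 0 < r₁)
    (h : sphereSum C r₁ = 1) {σ z : ℝ} (hσ : 0 < σ) (hz : z < Real.sqrt (m + 2 : ℕ)) :
    fu (signals C) σ z =
      (∫ r in Set.Ioc 0 (coneRadius (m + 2) r₁ z), condUnion C (z, r) * gs (m + 2) σ r) +
        ∫ r in Set.Ioi (coneRadius (m + 2) r₁ z), gs (m + 2) σ r := by
  have hP := isProbabilityMeasure_chiLaw (Nat.le_add_left 1 m) hσ
  have hR : coneRadius (m + 2) r₁ z = r₁ * (Real.sqrt (m + 2 : ℕ) - z) / Real.sqrt (m + 2 : ℕ) := by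
    have : 0 < Real.sqrt (m + 2 : ℕ) := by positivity
    rw [coneRadius]; field_simp
  have hR0 : 0 < coneRadius (m + 2) r₁ z := by
    rw [hR]; exact div_pos (mul_pos h₁ (sub_pos.2 hz)) (by positivity)
  set R := coneRadius (m + 2) r₁ z
  have hint := integrable_min_condUnion hm C (μ := chiLaw (m + 1) σ) (φ := fun r => (z, r))
    (by fun_prop)
  have hmem : ∀ r, 0 < r → (condUnion C (z, r) ≤ 1 ↔ r ≤ R) := fun r hr => by
    rw [condUnion_le_one_iff hm hC h₁ h (p := (z, r)) hr, hR]
    exact ⟨fun h => h.2, fun h => ⟨hz, h⟩⟩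
  rw [fu_signals C hσ, ← integral_add_compl (measurableSet_Iic (a := R)) hint, Set.compl_Iic,
    setIntegral_chiLaw (Nat.le_add_left 1 m) hσ measurableSet_Iic,
    setIntegral_chiLaw (Nat.le_add_left 1 m) hσ measurableSet_Ioi,
    Set.inter_comm, Set.Ioi_inter_Iic, Set.inter_eq_left.2 (Set.Ioi_subset_Ioi hR0.le)]
  congr 1
  · refine setIntegral_congr_fun measurableSet_Ioc fun r hr => ?_
    rw [min_eq_left ((hmem r hr.1).2 hr.2)]
  · refine setIntegral_congr_fun measurableSet_Ioi fun r hr => ?_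
    have hr0 : 0 < r := hR0.trans hr
    rw [min_eq_right, one_mul]
    by_contra hlt
    exact absurd ((hmem r hr0).1 (not_le.1 hlt).le) (not_le.2 hr)

lemma poltyrev_integrand (hm : 1 ≤ m) (hC : 2 ≤ Module.finrank (ZMod 2) C) (h₁ : 0 < r₁)
    (h : sphereSum C r₁ = 1) {σ z : ℝ} (hσ : 0 < σ) (hz : z < Real.sqrt (m + 2 : ℕ)) :
    (∑ d ∈ poltyrevWeights (m + 2) r₁, (weightCount C d : ℝ) *
        ∫ z₂ in boundary (m + 2) d z..coneRadius (m + 2) r₁ z,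
          g σ z₂ * ∫ v in (0 : ℝ)..(coneRadius (m + 2) r₁ z ^ 2 - z₂ ^ 2), chiSqPDF (m : ℕ) σ v)
      + (1 - ∫ y in (0 : ℝ)..(coneRadius (m + 2) r₁ z ^ 2), chiSqPDF (m + 1 : ℕ) σ y) =
    fu (signals C) σ z := by
  have hk : 0 < (Real.sqrt (m + 2 : ℕ) - z) / Real.sqrt (m + 2 : ℕ) :=
    div_pos (sub_pos.2 hz) (by positivity)
  have hR : coneRadius (m + 2) r₁ z =
      (Real.sqrt (m + 2 : ℕ) - z) / Real.sqrt (m + 2 : ℕ) * r₁ := by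
    have : 0 < Real.sqrt (m + 2 : ℕ) := by positivity
    rw [coneRadius]; field_simp
  have hR0 : 0 < coneRadius (m + 2) r₁ z := by
    rw [hR]; positivity
  rw [fu_eq_add hm hC h₁ h hσ hz]
  have hgs : IntegrableOn (gs (m + 2) σ) (Set.Ioi 0) := integrableOn_gs (Nat.le_add_left 1 m) hσ
  congr 1
  · have hsum := sum_innerWords_eq_sum_poltyrevWeights C h₁ (fun d =>
      ∫ r in Set.Ioc 0 (coneRadius (m + 2) r₁ z),
        capRatio (m + 2) (boundary (m + 2) d z / r) * gs (m + 2) σ r) (fun d _ _ hle => by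
      rw [setIntegral_congr_fun (g := fun _ => 0) measurableSet_Ioc, integral_zero]
      intro r hr
      have : 1 ≤ boundary (m + 2) d z / r := by
        rw [one_le_div hr.1, boundary_eq_mul (by omega)]
        refine hr.2.trans ?_
        rw [hR]
        exact mul_le_mul_of_nonneg_left hle hk.le
      simp [capRatio_of_one_le this])
    have hd : ∀ d ∈ poltyrevWeights (m + 2) r₁, (weightCount C d : ℝ) *
        (∫ z₂ in boundary (m + 2) d z..coneRadius (m + 2) r₁ z,
          g σ z₂ * ∫ v in (0 : ℝ)..(coneRadius (m + 2) r₁ z ^ 2 - z₂ ^ 2), chiSqPDF (m : ℕ) σ v) =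
        (weightCount C d : ℝ) * ∫ r in Set.Ioc 0 (coneRadius (m + 2) r₁ z),
        capRatio (m + 2) (boundary (m + 2) d z / r) * gs (m + 2) σ r := by
      intro d hd
      obtain ⟨hd1, hdn, hlt⟩ := (mem_poltyrevWeights h₁).1 hd
      rw [integral_g_mul_integral_chiSqPDF hm hσ (boundary_pos hd1 hdn hz)]
      rw [boundary_eq_mul (by omega), hR]
      exact mul_le_mul_of_nonneg_left hlt.le hk.le
    rw [Finset.sum_congr rfl hd, ← hsum, ← integral_finsetSum]
    · refine setIntegral_congr_fun measurableSet_Ioc fun r hr => ?_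
      rw [condUnion_eq_sum_innerWords C hz hr.1, Finset.sum_mul]
    · intro x _
      refine Integrable.bdd_mul (c := 1) (hgs.mono_set Set.Ioc_subset_Ioi_self) ?_ ?_
      · exact ((continuous_capRatio (m + 2)).measurable.comp
          (measurable_const.div measurable_id)).aestronglyMeasurable
      · filter_upwards [ae_restrict_mem measurableSet_Ioc] with r hr
        rw [Real.norm_eq_abs, abs_of_nonneg (capRatio_nonneg hm _)]
        refine (capRatio_le_half hm (div_nonneg ?_ hr.1.le)).trans (by norm_num)
        exact div_nonneg (mul_nonneg (Real.sqrt_nonneg _) (sub_pos.2 hz).le) (Real.sqrt_nonneg _)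
  · rw [integral_chiSqPDF (Nat.le_add_left 1 m) σ hR0.le, sub_eq_iff_eq_add',
      ← setIntegral_union Set.Ioc_disjoint_Ioi_same measurableSet_Ioi
        (hgs.mono_set Set.Ioc_subset_Ioi_self) (hgs.mono_set (Set.Ioi_subset_Ioi hR0.le)),
      Set.Ioc_union_Ioi_eq_Ioi hR0.le]
    exact (integral_gs (Nat.le_add_left 1 m) hσ).symm

lemma tsbValue_eq_poltyrevTSB (hm : 1 ≤ m) (hC : 2 ≤ Module.finrank (ZMod 2) C) (h₁ : 0 < r₁)
    (h : sphereSum C r₁ = 1) {σ : ℝ} (hσ : 0 < σ) :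
    tsbValue (signals C) σ (Real.sqrt (m + 2 : ℕ)) = poltyrevTSB C r₁ σ := by
  rw [tsbValue, poltyrevTSB, integral_Ioi_g hσ, integral_Iic_eq_integral_Iio,
    integral_Iic_eq_integral_Iio]
  congr 1
  refine setIntegral_congr_fun measurableSet_Iio fun z hz => ?_
  have e1 : ((m + 2 : ℕ) : ℝ) - 2 = (m : ℕ) := by push_cast; ring
  have e2 : ((m + 2 : ℕ) : ℝ) - 1 = (m + 1 : ℕ) := by push_cast; ring
  simp only [e1, e2]
  rw [← poltyrev_integrand hm hC h₁ h hσ hz, mul_comm]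
  rfl

end poltyrev

end TSB

end

theorem mainTheorem9 (n : ℕ) (hn : 3 ≤ n) (C : Submodule (ZMod 2) (Fin n → ZMod 2))
    (hC : 2 ≤ Module.finrank (ZMod 2) C) :
    -- the general bound, applied to the bipolar image of the code
    (∀ σ : ℝ, 0 < σ →
      (∀ z : ℝ, TSB.fu (TSB.signals C) σ z = TSB.fuCond (TSB.signals C) σ z (TSB.bpsk 0)) ∧
      (∀ z : ℝ, z < Real.sqrt n → TSB.fu (TSB.signals C) σ z < 1) ∧
      (∀ z : ℝ, Real.sqrt n ≤ z → TSB.fu (TSB.signals C) σ z = 1) ∧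
      (∀ t : ℝ, TSB.tsbValue (TSB.signals C) σ (Real.sqrt n) ≤ TSB.tsbValue (TSB.signals C) σ t) ∧
      (∀ t : ℝ, t < Real.sqrt n →
        TSB.tsbValue (TSB.signals C) σ (Real.sqrt n) < TSB.tsbValue (TSB.signals C) σ t) ∧
      TSB.generalTSB (TSB.signals C) σ = TSB.tsbValue (TSB.signals C) σ (Real.sqrt n) ∧
      (∀ D : TSB.Sig n → TSB.Sig n, TSB.IsMLDecoder (TSB.signals C) D →
        TSB.errorProb (TSB.signals C) D σ ≤ TSB.tsbValue (TSB.signals C) σ (Real.sqrt n))) ∧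
    (∀ r : ℝ, 0 < r → TSB.fs (TSB.signals C) 0 r (TSB.bpsk 0) = TSB.sphereSum C r) ∧
    -- at least three codewords other than the all-zero and the all-one word
    (3 ≤ Set.ncard {c : Fin n → ZMod 2 | c ∈ C ∧ c ≠ 0 ∧ c ≠ 1} →
      ∃ r₁ : ℝ, 0 < r₁ ∧ TSB.sphereSum C r₁ = 1 ∧
        (∀ r : ℝ, 0 < r → TSB.sphereSum C r = 1 → r = r₁) ∧
        (∀ r : ℝ, 0 < r → (TSB.PoltyrevOptimal C r ↔ r = r₁)) ∧
        -- the region given by the optimal radii in the hyperplanes is a half-cone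
        TSB.region (TSB.bpsk 0)
            {p : ℝ × ℝ | p.1 < Real.sqrt n ∧ p.2 ≤ r₁ * (Real.sqrt n - p.1) / Real.sqrt n}
          = TSB.halfCone (TSB.bpsk 0 : TSB.Sig n) (Real.arctan (r₁ / Real.sqrt n)) ∧
        ∀ σ : ℝ, 0 < σ →
          (∀ z : ℝ, z < Real.sqrt n → TSB.fu (TSB.signals C) σ z = TSB.fuLinear C r₁ σ z) ∧
          (∀ D : TSB.Sig n → TSB.Sig n, TSB.IsMLDecoder (TSB.signals C) D →
            TSB.errorProb (TSB.signals C) D σ ≤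
              (∫ z in Set.Iic (Real.sqrt n), TSB.fuLinear C r₁ σ z * TSB.g σ z) +
                (TSB.awgn n σ).real {w | Real.sqrt n ≤ TSB.radial (TSB.bpsk 0) w}) ∧
          (∫ z in Set.Iic (Real.sqrt n), TSB.fuLinear C r₁ σ z * TSB.g σ z) +
                (TSB.awgn n σ).real {w | Real.sqrt n ≤ TSB.radial (TSB.bpsk 0) w}
            = TSB.tsbValue (TSB.signals C) σ (Real.sqrt n) ∧
          -- optimality, and uniqueness up to null sets, of the half-cone
          TSB.regionBound (TSB.signals C) σ (TSB.bpsk 0)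
              (TSB.halfCone (TSB.bpsk 0) (Real.arctan (r₁ / Real.sqrt n)))
            = TSB.tsbValue (TSB.signals C) σ (Real.sqrt n) ∧
          (∀ A : Set (ℝ × ℝ), MeasurableSet A →
            TSB.tsbValue (TSB.signals C) σ (Real.sqrt n) ≤
                TSB.regionBound (TSB.signals C) σ (TSB.bpsk 0) (TSB.region (TSB.bpsk 0) A) ∧
            (TSB.regionBound (TSB.signals C) σ (TSB.bpsk 0) (TSB.region (TSB.bpsk 0) A)
                = TSB.tsbValue (TSB.signals C) σ (Real.sqrt n) →
              ∀ᵐ w ∂(TSB.awgn n σ), (TSB.bpsk 0 + w ∈ TSB.region (TSB.bpsk 0) A ↔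
                TSB.bpsk 0 + w ∈
                  TSB.halfCone (TSB.bpsk 0) (Real.arctan (r₁ / Real.sqrt n))))) ∧
          -- the bound of Poltyrev, with correction term
          TSB.tsbValue (TSB.signals C) σ (Real.sqrt n) = TSB.poltyrevTSB C r₁ σ) ∧
    -- the only other case: dimension two with the all-one word; the optimal radius is infinite
    (Set.ncard {c : Fin n → ZMod 2 | c ∈ C ∧ c ≠ 0 ∧ c ≠ 1} < 3 →
      (∀ r : ℝ, 0 < r → TSB.sphereSum C r < 1) ∧
      ∀ σ : ℝ, 0 < σ → ∀ z : ℝ, z < Real.sqrt n →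
        TSB.fu (TSB.signals C) σ z =
          ∫ r in Set.Ioi (0 : ℝ), TSB.sphereSum C r * TSB.gs n (TSB.sigmaTilde n σ z) r) := by
  obtain ⟨m, rfl⟩ : ∃ m, n = m + 2 := ⟨n - 2, by omega⟩
  have hm : 1 ≤ m := by omega
  refine ⟨fun σ hσ => ⟨fun z => ?_, fun z => TSB.fu_lt_one hm C hσ,
    fun z => TSB.fu_eq_one hm hC hσ, TSB.tsbValue_sqrt_le hm hC hσ,
    fun t => TSB.tsbValue_sqrt_lt hm hC hσ, ?_, fun D => TSB.errorProb_le hm hC hσ⟩,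
    fun r => TSB.fs_zero_eq_sphereSum C, fun h3 => ?_, fun h3 => ?_⟩
  · rw [TSB.fu_signals C hσ, TSB.fuCond_signals hσ C.zero_mem]
  · rw [TSB.generalTSB_eq hm C hσ, TSB.tsbValue_sqrt hm hC hσ]
  · rw [TSB.ncard_eq_card_innerWords] at h3
    obtain ⟨r₁, h₁, h⟩ := TSB.exists_sphereSum_eq_one hm h3
    refine ⟨r₁, h₁, h, fun r hr => (TSB.sphereSum_eq_one_iff hm h₁ h hr).1, fun r hr => ?_,
      TSB.region_conePairs (by omega) h₁, fun σ hσ => ⟨fun z => TSB.fu_eq_fuLinear hm h₁ h hσ,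
      fun D hD => ?_, TSB.integral_fuLinear_add hm h₁ h hσ,
      TSB.regionBound_halfCone hm hC h₁ h hσ, fun A hA =>
        ⟨TSB.tsbValue_le_regionBound hm hC hσ hA,
          TSB.ae_mem_region_iff_mem_halfCone hm hC h₁ h hσ hA⟩,
      TSB.tsbValue_eq_poltyrevTSB hm hC h₁ h hσ⟩⟩
    · rw [TSB.poltyrevOptimal_iff hm C hr, TSB.sphereSum_eq_one_iff hm h₁ h hr]
    · rw [TSB.integral_fuLinear_add hm h₁ h hσ]
      exact TSB.errorProb_le hm hC hσ hD
  · rw [TSB.ncard_eq_card_innerWords] at h3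
    refine ⟨fun r => TSB.sphereSum_lt_one hm h3, fun σ hσ z hz => ?_⟩
    rw [TSB.fu_eq_integral_sphereSum C hσ hz]
    refine setIntegral_congr_fun measurableSet_Ioi fun r hr => ?_
    rw [min_eq_left (TSB.sphereSum_lt_one hm h3 hr).le]
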